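/- **Setting.** Fix a non-empty, effectively presented set $K$ of constants. $\mathrm{CHR}(C)$ is the language of Constraint Handling Rules whose terms are variables and constants of $K$ (no function symbols of arity $>0$), and whose only built-in predicate is $=$, interpreted as equality on the Herbrand universe $K$; we write $B\models\varphi$ if every assignment of elements of $K$ to the free variables that satisfies $B$ satisfies $\varphi$. A program is a finite list of rules $H^k\backslash H^h\Leftrightarrow g\mid C$, where the heads $H^k,H^h$ are finite multisets of user-defined atoms, not both empty, $g$ is a conjunction of equations and $C$ is a finite multiset of user-defined atoms and equations. A goal is a finite multiset of user-defined atoms and equations. A program is *range-restricted* if, in each of its rules, every variable of $g$ and of $C$ occurs in $H^k$ or $H^h$. Programs are executed under the abstract semantics $\omega_o$ (without propagation history). Configurations are $\langle G,S,B\rangle_n$, with $G$ a goal, $S$ a set of atoms with identifiers, $B$ a conjunction of equations and $n$ the next identifier; the initial configuration for $G$ is $\langle G,\emptyset,\mathit{true}\rangle_1$. The transitions are: * Solve: $\langle\{c\}\uplus G,S,B\rangle_n\to\langle G,S,c\wedge B\rangle_n$ for an equation $c$. * Introduce: $\langle\{c\}\uplus G,S,B\rangle_n\to\langle G,\{c\#n\}\cup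 S,B\rangle_{n+1}$ for a user-defined atom $c$. * Apply: $\langle G,H_1\cup H_2\cup S,B\rangle_n\to\langle C\uplus G,H_1\cup S,\theta\wedge B\rangle_n$ if $H'_1\backslash H'_2\Leftrightarrow g\mid C$ is a rule of the program, renamed apart from the configuration, and $\theta$ is a substitution on its head variables such that $B\models \mathrm{chr}(H_1)=H'_1\theta$, $B\models\mathrm{chr}(H_2)=H'_2\theta$ (as multisets of atoms, $\mathrm{chr}$ forgetting identifiers) and $B\models\exists\bar x\,(\theta\wedge g)$, where $\bar x$ are the variables not occurring in the configuration and $\theta$ is read as a conjunction of equations. A configuration is *final* if $B$ is unsatisfiable, or if its goal is empty and no transition applies. A computation is *terminating* if it ends in a final configuration; otherwise it is infinite. An *encoding* of Turing machines into range-restricted $\mathrm{CHR}(C)$ is a computable function $f$ that maps a (deterministic, one-tape) Turing machine $Z$ and an initial instantaneous description $D$ of $Z$ (an input word) to a pair $f(Z,D)=(P,G)$ of a range-restricted $\mathrm{CHR}(C)$ program $P$ and a goal $G$. It is *termination preserving* if for all $Z$ and $D$: the machine $Z$ started with $D$ terminates if and only if the goal $G$ has only terminating computations in the program $P$, where $(P,G)=f(Z,D)$.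 **Corollary.** There exists no termination preserving encoding of Turing machines into range-restricted $\mathrm{CHR}(C)$. -/

import Mathlib

/-! Constraint Handling Rules over a signature whose only function symbols are constants and whose
only built-in predicate is equality on the Herbrand universe, that is, on the set `K` of constants.
Syntax is finite data, so that encodings into it can be required to be computable: multisets and
conjunctions in programs and goals are presented by lists, and are only used as multisets below. -/

namespace CHR

/-- Terms: variables (named by natural numbers) and constants. -/
inductive Term (K : Type*) where
  | var (v : ℕ)
  | const (k : K)

/-- A user-defined (CHR) constraint `p(t₁, …, tₙ)`. A predicate symbol is a name together with an
arity, the arity being the number of arguments. -/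
structure Atom (K : Type*) where
  pred : ℕ
  args : List (Term K)

/-- A built-in constraint `s = t`. -/
structure Eqn (K : Type*) where
  lhs : Term K
  rhs : Term K

/-- A constraint is either user-defined or built-in. -/
inductive Constraint (K : Type*) where
  | user (a : Atom K)
  | builtin (e : Eqn K)

/-- A simpagation rule `kept \ removed ⟺ guard | body`; the empty guard is `true`. -/
structure Rule (K : Type*) where
  kept : List (Atom K)
  removed : List (Atom K)
  guard : List (Eqn K)
  body : List (Constraint K)

/-- Programs are sequences of rules; a rule is identified by its position. -/
abbrev Program (K : Type*) := List (Rule K)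

abbrev Goal (K : Type*) := List (Constraint K)

/-! ### Syntax as data -/

def Term.equiv (K : Type*) : Term K ≃ ℕ ⊕ K where
  toFun t := match t with
    | .var v => .inl v
    | .const k => .inr k
  invFun s := match s with
    | .inl v => .var v
    | .inr k => .const k
  left_inv t := by cases t <;> rfl
  right_inv s := by cases s <;> rfl

def Atom.equiv (K : Type*) : Atom K ≃ ℕ × List (Term K) where
  toFun a := (a.pred, a.args)
  invFun p := ⟨p.1, p.2⟩
  left_inv _ := rfl
  right_inv _ := rfl

def Eqn.equiv (K : Type*) : Eqn K ≃ Term K × Term K where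
  toFun e := (e.lhs, e.rhs)
  invFun p := ⟨p.1, p.2⟩
  left_inv _ := rfl
  right_inv _ := rfl

def Constraint.equiv (K : Type*) : Constraint K ≃ Atom K ⊕ Eqn K where
  toFun c := match c with
    | .user a => .inl a
    | .builtin e => .inr e
  invFun s := match s with
    | .inl a => .user a
    | .inr e => .builtin e
  left_inv c := by cases c <;> rfl
  right_inv s := by cases s <;> rfl

def Rule.equiv (K : Type*) :
    Rule K ≃ List (Atom K) × List (Atom K) × List (Eqn K) × List (Constraint K) where
  toFun r := (r.kept, r.removed, r.guard, r.body)
  invFun p := ⟨p.1, p.2.1, p.2.2.1, p.2.2.2⟩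
  left_inv _ := rfl
  right_inv _ := rfl

instance instPrimcodableTerm {K : Type*} [Primcodable K] : Primcodable (Term K) :=
  Primcodable.ofEquiv _ (Term.equiv K)

instance instPrimcodableAtom {K : Type*} [Primcodable K] : Primcodable (Atom K) :=
  Primcodable.ofEquiv _ (Atom.equiv K)

instance instPrimcodableEqn {K : Type*} [Primcodable K] : Primcodable (Eqn K) :=
  Primcodable.ofEquiv _ (Eqn.equiv K)

instance instPrimcodableConstraint {K : Type*} [Primcodable K] : Primcodable (Constraint K) :=
  Primcodable.ofEquiv _ (Constraint.equiv K)

instance instPrimcodableRule {K : Type*} [Primcodable K] : Primcodable (Rule K) :=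
  Primcodable.ofEquiv _ (Rule.equiv K)

/-! ### Variables and substitutions -/

section Variables

variable {K : Type*}

def Term.vars : Term K → List ℕ
  | .var v => [v]
  | .const _ => []

def Atom.vars (a : Atom K) : List ℕ := a.args.flatMap Term.vars

def Eqn.vars (e : Eqn K) : List ℕ := e.lhs.vars ++ e.rhs.vars

def Constraint.vars : Constraint K → List ℕ
  | .user a => a.vars
  | .builtin e => e.vars

/-- The variables of the two heads of a rule. -/
def Rule.headVars (r : Rule K) : List ℕ := (r.kept ++ r.removed).flatMap Atom.vars

def Rule.guardVars (r : Rule K) : List ℕ := r.guard.flatMap Eqn.vars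

def Rule.bodyVars (r : Rule K) : List ℕ := r.body.flatMap Constraint.vars

def Rule.vars (r : Rule K) : List ℕ := r.headVars ++ r.guardVars ++ r.bodyVars

def Term.subst (θ : ℕ → Term K) : Term K → Term K
  | .var v => θ v
  | .const k => .const k

def Atom.subst (θ : ℕ → Term K) (a : Atom K) : Atom K :=
  ⟨a.pred, a.args.map (Term.subst θ)⟩

def Eqn.subst (θ : ℕ → Term K) (e : Eqn K) : Eqn K := ⟨e.lhs.subst θ, e.rhs.subst θ⟩

def Constraint.subst (θ : ℕ → Term K) : Constraint K → Constraint K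
  | .user a => .user (a.subst θ)
  | .builtin e => .builtin (e.subst θ)

/-- The rule with every variable `v` renamed to `ρ v`. -/
def Rule.rename (ρ : ℕ → ℕ) (r : Rule K) : Rule K where
  kept := r.kept.map (Atom.subst fun v => .var (ρ v))
  removed := r.removed.map (Atom.subst fun v => .var (ρ v))
  guard := r.guard.map (Eqn.subst fun v => .var (ρ v))
  body := r.body.map (Constraint.subst fun v => .var (ρ v))

/-- At least one of the two heads is non-empty. -/
def Rule.WellFormed (r : Rule K) : Prop := r.kept ≠ [] ∨ r.removed ≠ []

/-- Every variable of the body or of the guard occurs in the head. -/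
def Rule.RangeRestricted (r : Rule K) : Prop :=
  ∀ v, v ∈ r.bodyVars ∨ v ∈ r.guardVars → v ∈ r.headVars

def Program.WellFormed (P : Program K) : Prop := ∀ r ∈ P, r.WellFormed

def Program.RangeRestricted (P : Program K) : Prop := ∀ r ∈ P, r.RangeRestricted

end Variables

/-! ### Equality on the Herbrand universe -/

section Theory

variable {K : Type*}

def Term.val (ν : ℕ → K) : Term K → K
  | .var v => ν v
  | .const k => k

/-- `ν` satisfies the conjunction of the equations in `B`. -/
def Holds (ν : ℕ → K) (B : Multiset (Eqn K)) : Prop :=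
  ∀ e ∈ B, e.lhs.val ν = e.rhs.val ν

/-- `B → s = t` is valid. -/
def EntailsEq (B : Multiset (Eqn K)) (s t : Term K) : Prop :=
  ∀ ν : ℕ → K, Holds ν B → s.val ν = t.val ν

/-- `B → a = b` is valid, for CHR constraints `a` and `b`: same predicate symbol, and arguments
which `B` entails to be pairwise equal. -/
def EntailsAtomEq (B : Multiset (Eqn K)) (a b : Atom K) : Prop :=
  a.pred = b.pred ∧ List.Forall₂ (EntailsEq B) a.args b.args

/-- `B → ∃_{-V} C` is valid, where `∃_{-V}` quantifies over all variables outside `V`. -/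
def EntailsEx (B : Multiset (Eqn K)) (V : Set ℕ) (C : Multiset (Eqn K)) : Prop :=
  ∀ ν : ℕ → K, Holds ν B → ∃ ν' : ℕ → K, (∀ v ∈ V, ν' v = ν v) ∧ Holds ν' C

end Theory

/-! ### The abstract operational semantics -/

section Semantics

variable {K : Type*}

/-- Configurations `⟨G, S, B⟩ₙ`. An identified constraint `c#i` is the pair `(c, i)`; identifiers
are unique in every configuration of a computation, so the multiset `store` is then a set. -/
structure Config (K : Type*) where
  goal : Multiset (Constraint K)
  store : Multiset (Atom K × ℕ)
  builtin : Multiset (Eqn K)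
  next : ℕ

/-- The variables occurring in a configuration. -/
def Config.vars (s : Config K) : Set ℕ :=
  {v | (∃ c ∈ s.goal, v ∈ c.vars) ∨ (∃ p ∈ s.store, v ∈ p.1.vars) ∨ ∃ e ∈ s.builtin, v ∈ e.vars}

/-- The substitution `θ`, restricted to the variables in `vs`, as a conjunction of equations. -/
def substEqns (vs : List ℕ) (θ : ℕ → Term K) : Multiset (Eqn K) :=
  ↑(vs.dedup.map fun v => (⟨.var v, θ v⟩ : Eqn K))

/-- One transition of the abstract semantics (the one without propagation history). In `apply`, the
rule is renamed apart from the configuration by `ρ`, the heads are matched against constraints of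
the store modulo the equalities entailed by the built-in store, and the built-in store has to
entail that the instance of the guard holds for some values of the remaining rule variables. -/
inductive Step (P : Program K) : Config K → Config K → Prop where
  | solve (e : Eqn K) (G : Multiset (Constraint K)) (S : Multiset (Atom K × ℕ))
      (B : Multiset (Eqn K)) (n : ℕ) :
      Step P ⟨.builtin e ::ₘ G, S, B, n⟩ ⟨G, S, e ::ₘ B, n⟩
  | introduce (a : Atom K) (G : Multiset (Constraint K)) (S : Multiset (Atom K × ℕ))
      (B : Multiset (Eqn K)) (n : ℕ) :
      Step P ⟨.user a ::ₘ G, S, B, n⟩ ⟨G, (a, n) ::ₘ S, B, n + 1⟩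
  | apply (G : Multiset (Constraint K)) (H₁ H₂ S : Multiset (Atom K × ℕ))
      (B : Multiset (Eqn K)) (n : ℕ) (r r' : Rule K) (ρ : ℕ → ℕ) (θ : ℕ → Term K)
      (mem : r ∈ P)
      (inj : Function.Injective ρ)
      (ren : r' = r.rename ρ)
      (fresh : ∀ v ∈ r'.vars, v ∉ Config.vars ⟨G, H₁ + H₂ + S, B, n⟩)
      (match_kept : Multiset.Rel (EntailsAtomEq B) (H₁.map Prod.fst)
        ↑(r'.kept.map (Atom.subst θ)))
      (match_removed : Multiset.Rel (EntailsAtomEq B) (H₂.map Prod.fst)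
        ↑(r'.removed.map (Atom.subst θ)))
      (guard : EntailsEx B (Config.vars ⟨G, H₁ + H₂ + S, B, n⟩)
        (substEqns r'.headVars θ + ↑r'.guard)) :
      Step P ⟨G, H₁ + H₂ + S, B, n⟩ ⟨↑r'.body + G, H₁ + S, substEqns r'.headVars θ + B, n⟩

/-- The initial configuration `⟨G, ∅, true⟩₁`. -/
def Config.initial (G : Goal K) : Config K := ⟨↑G, 0, 0, 1⟩

/-- The built-in store is equivalent to `false`. -/
def Config.Failed (s : Config K) : Prop := ¬ ∃ ν : ℕ → K, Holds ν s.builtin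

/-- Final configurations: failed ones, and successfully terminated ones. -/
def Config.Final (P : Program K) (s : Config K) : Prop :=
  s.Failed ∨ (s.goal = 0 ∧ ¬ ∃ s', Step P s s')

/-- An infinite computation for the goal `G` in `P`: it never reaches a final configuration. -/
def InfiniteComputation (P : Program K) (G : Goal K) (s : ℕ → Config K) : Prop :=
  s 0 = Config.initial G ∧ ∀ i, ¬ (s i).Final P ∧ Step P (s i) (s (i + 1))

/-- The goal `G` has only terminating computations in `P`, i.e. none is infinite. (A computation
only stops in a final configuration, since a non-empty goal always allows a transition.) -/
def OnlyTerminatingComputations (P : Program K) (G : Goal K) : Prop :=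
  ¬ ∃ s : ℕ → Config K, InfiniteComputation P G s

end Semantics

/-! ### Turing machines as finite data -/

def dirEquiv : Turing.Dir ≃ Bool where
  toFun d := match d with
    | .left => false
    | .right => true
  invFun b := match b with
    | false => .left
    | true => .right
  left_inv d := by cases d <;> rfl
  right_inv b := by cases b <;> rfl

def stmtEquiv : Turing.TM0.Stmt ℕ ≃ Bool ⊕ ℕ where
  toFun s := match s with
    | .move d => .inl (dirEquiv d)
    | .write a => .inr a
  invFun s := match s with
    | .inl b => .move (dirEquiv.symm b)
    | .inr a => .write a
  left_inv s := by cases s <;> simp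
  right_inv s := by cases s <;> simp

instance instPrimcodableStmt : Primcodable (Turing.TM0.Stmt ℕ) :=
  Primcodable.ofEquiv _ stmtEquiv

/-- A Turing machine, given by its finite transition table: the entry `((q, a), (q', s))` says that
in state `q`, reading `a`, the machine performs the action `s` (a move, or writing a symbol) and
enters state `q'`. States and tape symbols are natural numbers, the initial state is `0` and the
blank symbol is `0`. -/
abbrev TuringMachine := List ((ℕ × ℕ) × (ℕ × Turing.TM0.Stmt ℕ))

/-- The transition function: the first entry for `(q, a)`, if any; otherwise the machine halts. -/
def TuringMachine.toTM0 (Z : TuringMachine) : Turing.TM0.Machine ℕ ℕ :=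
  fun q a => List.lookup (q, a) Z

/-- The machine `Z` halts when started in its initial state on the first symbol of the word `D`,
the rest of the tape being blank. -/
def TuringMachine.Halts (Z : TuringMachine) (D : List ℕ) : Prop :=
  (Turing.TM0.eval Z.toTM0 D).Dom

/-! ### Encodings -/

/-- `f` maps a machine and an initial instantaneous description to a range-restricted program
and a goal. -/
def IntoRangeRestricted {K : Type*} (f : TuringMachine × List ℕ → Program K × Goal K) : Prop :=
  ∀ Z D, (f (Z, D)).1.WellFormed ∧ (f (Z, D)).1.RangeRestricted

def TerminationPreserving {K : Type*} (f : TuringMachine × List ℕ → Program K × Goal K) : Prop :=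
  ∀ Z D, Z.Halts D ↔ OnlyTerminatingComputations (f (Z, D)).1 (f (Z, D)).2

end CHR

/-!
Non-termination of range-restricted programs is recursively enumerable, whereas non-halting of
Turing machines is not; so no computable map into such programs can make halting of the machine
equivalent to termination of all computations.

Non-termination is enumerable because it has finite certificates. Modulo the equalities entailed by
the built-in store, a configuration is a multiset of constraints with a mark for membership in the
goal or in the store: a most general solution `σ` of the built-in store (`SolvedForm`) turns
entailed equality into syntactic equality of the instances under `σ`. This yields an abstract
transition system (`Transition`) without built-in store, identifiers and fresh variables, which is
related to the operational semantics by a bisimulation (`Represents.exists_transition`,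
`Represents.exists_step`). Over a single constant all terms are equal, and the abstract system is
started from a ground instance of the goal.

The abstract system is well structured. Its transitions are monotone for inclusion of multisets
(`Transition.exists_extend`), and by range restriction no terms are created, so that only
finitely many items occur in a run (`Transition.bounded_post`, `finite_bounded`). Higman's lemma
then provides, in every infinite run, a state that is included in a later one; conversely such a
repetition can be iterated for ever. A `Certificate` is the set of transitions of such a loop with
the path leading to it, and to be a certificate is a primitive recursive property.

For Turing machines a single universal machine suffices: the translations of Mathlib from partial
recursive functions to Post–Turing machines produce finitely many states and symbols, hence a
finite table. Its inputs encode `2 ^ n`, whose binary expansion is a unary numeral for `n`.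
-/

namespace CHR

/-! ### A Turing machine with a non-recursive halting problem -/

section TuringMachines

open Turing

/-- The encoding of states and symbols: the initial state and the blank have to be named `0`. -/
theorem exists_injOn_nat_default {α : Type*} [Inhabited α] {s : Set α} (hs : s.Finite) :
    ∃ f : α → ℕ, f default = 0 ∧ ∀ a ∈ s, ∀ b, b ∈ s → f a = f b → a = b := by
  classical
  obtain ⟨f, hf⟩ := Set.countable_iff_exists_injOn.1 hs.countable
  refine ⟨fun a => if a = default then 0 else f a + 1, by simp, fun a ha b hb h => ?_⟩
  by_cases h1 : a = default <;> by_cases h2 : b = default <;> simp [h1, h2] at h ⊢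
  exact hf ha hb h

theorem lookup_eq_of_forall_mem_iff {α β : Type*} [BEq α] [LawfulBEq α] {l : List (α × β)} {k : α}
    {o : Option β} (h : ∀ v, (k, v) ∈ l ↔ o = some v) : l.lookup k = o := by
  cases e : l.lookup k with
  | none =>
    cases o with
    | none => rfl
    | some v =>
      have := List.lookup_eq_none_iff.1 e _ ((h v).2 rfl)
      simp at this
  | some v =>
    obtain ⟨l₁, l₂, rfl, -⟩ := List.lookup_eq_some_iff.1 e
    exact ((h v).1 (by simp)).symm

/-- A Post–Turing machine over a finite alphabet that uses finitely many states is given by a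
finite table, after renaming its states and symbols to natural numbers. -/
theorem exists_table_of_supports {Γ Λ : Type*} [Inhabited Γ] [Finite Γ] [Inhabited Λ]
    (M : TM0.Machine Γ Λ) (S : Finset Λ) (hS : TM0.Supports M ↑S) :
    ∃ (Z : TuringMachine) (f : Γ → ℕ),
      ∀ l, Z.Halts (l.map f) ↔ (TM0.eval M l).Dom := by
  classical
  obtain ⟨g, g0, hg⟩ := exists_injOn_nat_default S.finite_toSet
  obtain ⟨f, f0, hf⟩ := exists_injOn_nat_default (Set.finite_univ (α := Γ))
  have : Fintype Γ := Fintype.ofFinite Γ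
  let F : PointedMap Γ ℕ := ⟨f, f0⟩
  let entry : Λ × Γ → Option ((ℕ × ℕ) × (ℕ × TM0.Stmt ℕ)) := fun p =>
    (M p.1 p.2).map fun r => ((g p.1, f p.2), (g r.1, r.2.map F))
  let Z : TuringMachine := (S ×ˢ (Finset.univ : Finset Γ)).toList.filterMap entry
  have hZ : ∀ q ∈ S, ∀ a, Z.toTM0 (g q) (f a) = (M q a).map (Prod.map g (TM0.Stmt.map F)) := by
    intro q hq a
    refine lookup_eq_of_forall_mem_iff fun v => ?_
    simp only [Z, List.mem_filterMap, Finset.mem_toList, Finset.mem_product, Finset.mem_univ,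
      and_true, entry, Option.map_eq_some_iff, Prod.mk.injEq, Prod.exists]
    constructor
    · rintro ⟨q', a', hq', q'', s, e, ⟨e1, e2⟩, rfl⟩
      obtain rfl := hg _ hq' _ hq e1
      obtain rfl := hf _ trivial _ trivial e2
      exact ⟨q'', s, e, rfl⟩
    · rintro ⟨q'', s, e, rfl⟩
      exact ⟨q, a, hq, q'', s, e, ⟨rfl, rfl⟩, rfl⟩
  have hstep : ∀ c : TM0.Cfg Γ Λ, c.q ∈ S →
      (TM0.step M c).map (TM0.Cfg.map F g) = TM0.step Z.toTM0 (TM0.Cfg.map F g c) := by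
    rintro ⟨q, T⟩ h
    unfold TM0.step TM0.Cfg.map
    have h1 : Z.toTM0 (g q) (Tape.map F T).head =
        (M q T.head).map (Prod.map g (TM0.Stmt.map F)) := by
      rw [Tape.map_fst]; exact hZ q h T.head
    simp only [h1]
    rcases M q T.1 with (_ | ⟨q', d | a⟩)
    · rfl
    · simp only [Option.map_some, Tape.map_move F]
      rfl
    · simp only [Option.map_some, Tape.map_write]
      rfl
  have hres : StateTransition.Respects (TM0.step M) (TM0.step Z.toTM0)
      fun a b => a.q ∈ S ∧ TM0.Cfg.map F g a = b := by
    rintro c _ ⟨cs, rfl⟩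
    cases e : TM0.step M c
    · rw [← hstep _ cs, e]
      rfl
    · refine ⟨_, ⟨TM0.step_supports M hS e cs, rfl⟩, Relation.TransGen.single ?_⟩
      rw [← hstep _ cs, e]
      rfl
  refine ⟨Z, f, fun l => ?_⟩
  exact StateTransition.tr_eval_dom hres
    ⟨hS.1, TM0.map_init F (⟨g, g0⟩ : PointedMap Λ ℕ) l⟩

open PartrecToTM2 in
theorem trNat_two_pow (n : ℕ) :
    trNat (2 ^ n) = List.replicate n Γ'.bit0 ++ [Γ'.bit1] := by
  have : ∀ n : ℕ, ∃ p : PosNum, ((2 ^ n : ℕ) : Num) = Num.pos p ∧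
      trPosNum p = List.replicate n Γ'.bit0 ++ [Γ'.bit1] := by
    intro n
    induction n with
    | zero => exact ⟨1, by simp; rfl, rfl⟩
    | succ n ih =>
      obtain ⟨p, h1, h2⟩ := ih
      refine ⟨p.bit0, ?_, by simp [trPosNum, h2, List.replicate_succ]⟩
      rw [pow_succ, mul_two, Nat.cast_add, h1]
      exact (Num.bit0_of_bit0 (Num.pos p)).symm ▸ rfl
  obtain ⟨p, h1, h2⟩ := this n
  rw [trNat, h1]; exact h2

open PartrecToTM2 in
/-- Every recursively enumerable set of numbers reduces to the halting of one finite machine. It is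
run on `2 ^ n` rather than on `n`, because the binary representation of `2 ^ n` is given by a unary
numeral, so that the input is evidently primitive recursive in `n`. -/
theorem exists_turingMachine_halts_iff {p : ℕ → Prop} (hp : REPred p) :
    ∃ (Z : TuringMachine) (D : ℕ → List ℕ), Primrec D ∧ ∀ n, Z.Halts (D n) ↔ p n := by
  classical
  -- a partial recursive function defined exactly at the powers `2 ^ n` with `p n`
  obtain ⟨g, hg, hgp⟩ : ∃ g : ℕ →. ℕ, Partrec g ∧ ∀ n, (g (2 ^ n)).Dom ↔ p n := by
    have h1 : Partrec fun m : ℕ => Nat.rfind fun n => Part.some (decide (2 ^ n = m)) := by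
      refine Partrec.rfind (Computable.partrec ?_)
      exact (Primrec.eq.comp
        ((Primrec₂.unpaired'.1 Nat.Primrec.pow).comp (Primrec.const 2) Primrec.snd)
        Primrec.fst).decide.to_comp
    have h2 := h1.bind (g := fun _ n => (Part.assert (p n) fun _ => Part.some ()).map fun _ => 0)
      (((hp.comp Computable.snd).map (Computable.const 0).to₂))
    refine ⟨_, h2, fun n => ?_⟩
    have : (Nat.rfind fun k => Part.some (decide (2 ^ k = 2 ^ n))) = Part.some n := by
      refine Part.eq_some_iff.2 (Nat.mem_rfind.2 ⟨by simp, fun {m} hm => ?_⟩)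
      simp; omega
    simp only [this]
    simp [Part.assert]
  obtain ⟨c, hc⟩ := ToPartrec.Code.exists_code (Nat.Partrec'.part_iff₁.2 hg)
  let _ : Inhabited Λ' := ⟨trNormal c Cont'.halt⟩
  have hS2 : TM2.Supports PartrecToTM2.tr (codeSupp c Cont'.halt) := tr_supports c Cont'.halt
  have hS1 := TM2to1.tr_supports _ hS2
  have hS0 := TM1to0.tr_supports _ hS1
  have : Fintype K' := ⟨{.main, .rev, .aux, .stack}, fun k => by cases k <;> simp⟩
  have : Finite (TM2to1.Γ' K' fun _ => Γ') :=
    inferInstanceAs (Finite (Bool × (K' → Option Γ')))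
  obtain ⟨Z, f, hZ⟩ := exists_table_of_supports _ _ hS0
  refine ⟨Z, fun n => (TM2to1.trInit K'.main (trList [2 ^ n])).map f, ?_, fun n => ?_⟩
  · have h : Primrec fun n : ℕ =>
        f (true, Function.update (fun _ => none) K'.main (some Γ'.cons)) ::
        f (false, Function.update (fun _ => none) K'.main (some Γ'.bit1)) ::
        (List.range n).map fun _ =>
          f (false, Function.update (fun _ => none) K'.main (some Γ'.bit0)) :=
      Primrec.list_cons.comp (Primrec.const _) (Primrec.list_cons.comp (Primrec.const _)
        (Primrec.list_map Primrec.list_range (Primrec.const _).to₂))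
    refine h.of_eq fun n => ?_
    rw [List.map_const', List.length_range]
    have e : (trList [2 ^ n]).reverse = Γ'.cons :: Γ'.bit1 :: List.replicate n Γ'.bit0 := by
      simp [trNat_two_pow]
    rw [TM2to1.trInit, e]
    refine congrArg (List.cons _ ∘ List.cons _) (Eq.trans ?_ List.map_map.symm)
    rw [List.map_replicate]
    rfl
  · rw [hZ, TM1to0.tr_eval, ← hgp]
    refine (TM2to1.tr_eval_dom PartrecToTM2.tr K'.main (trList [2 ^ n])).trans ?_
    have h1 : (TM2.init K'.main (trList [2 ^ n]) :
        TM2.Cfg (fun _ : K' => Γ') Λ' (Option Γ')) = PartrecToTM2.init c [2 ^ n] := by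
      unfold TM2.init PartrecToTM2.init
      congr 1
      funext k; cases k <;> rfl
    have h2 := hc ⟨[2 ^ n], rfl⟩
    change (StateTransition.eval (TM2.step PartrecToTM2.tr)
      (TM2.init K'.main (trList [2 ^ n]))).Dom ↔ _
    rw [h1, PartrecToTM2.tr_eval, h2]
    simp
    rfl

end TuringMachines

/-! ### Primitive recursive operations on the syntax -/

section Primrec

variable {K : Type*} [Primcodable K] {α : Type*} [Primcodable α]

theorem primrec_termVar : Primrec (Term.var : ℕ → Term K) :=
  (Primrec.of_equiv_symm (e := Term.equiv K)).comp Primrec.sumInl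

theorem primrec_term_casesOn {β : Type*} [Primcodable β] {f : α → Term K} {g : α → ℕ → β}
    {h : α → K → β} (hf : Primrec f) (hg : Primrec₂ g) (hh : Primrec₂ h) :
    Primrec fun a => (Term.casesOn (f a) (g a) (h a) : β) := by
  refine (Primrec.sumCasesOn ((Primrec.of_equiv (e := Term.equiv K)).comp hf) hg hh).of_eq ?_
  intro a
  dsimp only
  cases f a <;> rfl

theorem primrec_term_subst {θ : α → ℕ → Term K} (hθ : Primrec₂ θ) :
    Primrec₂ fun a (t : Term K) => t.subst (θ a) := by
  refine (primrec_term_casesOn Primrec.snd (hθ.comp (Primrec.fst.comp Primrec.fst) Primrec.snd).to₂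
    ((Primrec.of_equiv_symm (e := Term.equiv K)).comp
      (Primrec.sumInr.comp Primrec.snd)).to₂).of_eq ?_
  rintro ⟨a, t⟩
  cases t <;> rfl

theorem primrec_atom_subst {θ : α → ℕ → Term K} (hθ : Primrec₂ θ) :
    Primrec₂ fun a (c : Atom K) => c.subst (θ a) := by
  have he : Primrec fun p : α × Atom K => Atom.equiv K p.2 :=
    (Primrec.of_equiv (e := Atom.equiv K)).comp Primrec.snd
  exact (Primrec.of_equiv_symm (e := Atom.equiv K)).comp ((Primrec.fst.comp he).pair
    (Primrec.list_map (Primrec.snd.comp he)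
      ((primrec_term_subst hθ).comp (Primrec.fst.comp Primrec.fst) Primrec.snd).to₂))

theorem primrec_eqn_lhs : Primrec (Eqn.lhs : Eqn K → Term K) :=
  Primrec.fst.comp (Primrec.of_equiv (e := Eqn.equiv K))

theorem primrec_eqn_rhs : Primrec (Eqn.rhs : Eqn K → Term K) :=
  Primrec.snd.comp (Primrec.of_equiv (e := Eqn.equiv K))

theorem primrec_eqn_subst {θ : α → ℕ → Term K} (hθ : Primrec₂ θ) :
    Primrec₂ fun a (e : Eqn K) => e.subst (θ a) :=
  (Primrec.of_equiv_symm (e := Eqn.equiv K)).comp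
    (((primrec_term_subst hθ).comp Primrec.fst (primrec_eqn_lhs.comp Primrec.snd)).pair
      ((primrec_term_subst hθ).comp Primrec.fst (primrec_eqn_rhs.comp Primrec.snd)))

theorem primrec_constraint_user : Primrec (Constraint.user : Atom K → Constraint K) :=
  (Primrec.of_equiv_symm (e := Constraint.equiv K)).comp Primrec.sumInl

theorem primrec_constraint_builtin : Primrec (Constraint.builtin : Eqn K → Constraint K) :=
  (Primrec.of_equiv_symm (e := Constraint.equiv K)).comp Primrec.sumInr

theorem primrec_constraint_casesOn {β : Type*} [Primcodable β] {f : α → Constraint K}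
    {g : α → Atom K → β} {h : α → Eqn K → β} (hf : Primrec f) (hg : Primrec₂ g)
    (hh : Primrec₂ h) : Primrec fun a => (Constraint.casesOn (f a) (g a) (h a) : β) := by
  refine (Primrec.sumCasesOn ((Primrec.of_equiv (e := Constraint.equiv K)).comp hf) hg hh).of_eq ?_
  intro a
  dsimp only
  cases f a <;> rfl

theorem primrec_constraint_subst {θ : α → ℕ → Term K} (hθ : Primrec₂ θ) :
    Primrec₂ fun a (c : Constraint K) => c.subst (θ a) := by
  refine (primrec_constraint_casesOn Primrec.snd
    (primrec_constraint_user.comp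
      ((primrec_atom_subst hθ).comp (Primrec.fst.comp Primrec.fst) Primrec.snd)).to₂
    (primrec_constraint_builtin.comp
      ((primrec_eqn_subst hθ).comp (Primrec.fst.comp Primrec.fst) Primrec.snd)).to₂).of_eq ?_
  rintro ⟨a, c⟩
  cases c <;> rfl

theorem primrec_rule_kept : Primrec (Rule.kept : Rule K → List (Atom K)) :=
  Primrec.fst.comp (Primrec.of_equiv (e := Rule.equiv K))

theorem primrec_rule_removed : Primrec (Rule.removed : Rule K → List (Atom K)) :=
  (Primrec.fst.comp Primrec.snd).comp (Primrec.of_equiv (e := Rule.equiv K))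

theorem primrec_rule_guard : Primrec (Rule.guard : Rule K → List (Eqn K)) :=
  (Primrec.fst.comp (Primrec.snd.comp Primrec.snd)).comp (Primrec.of_equiv (e := Rule.equiv K))

theorem primrec_rule_body : Primrec (Rule.body : Rule K → List (Constraint K)) :=
  (Primrec.snd.comp (Primrec.snd.comp Primrec.snd)).comp (Primrec.of_equiv (e := Rule.equiv K))

open Classical in
theorem primrecRel_subperm : PrimrecRel fun l₁ l₂ : List α => l₁.Subperm l₂ := by
  have hcount : Primrec₂ fun (l : List α) (a : α) => l.count a := by
    have h : PrimrecRel fun a b : α => a = b := Primrec.eq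
    refine (Primrec.list_length.comp₂ h.listFilter).of_eq fun p a => ?_
    rw [List.count_eq_length_filter]
    congr 2
  have hle : PrimrecRel fun (a : α) (q : List α × List α) => q.1.count a ≤ q.2.count a :=
    Primrec.nat_le.comp (hcount.comp (Primrec.fst.comp Primrec.snd) Primrec.fst)
      (hcount.comp (Primrec.snd.comp Primrec.snd) Primrec.fst)
  exact (hle.forall_mem_list.comp Primrec.fst Primrec.id).of_eq fun p =>
    List.subperm_ext_iff.symm

/-- Unbounded search: a projection of a primitive recursive relation is recursively enumerable. -/
theorem rePred_exists {β : Type*} [Primcodable β] {R : α → β → Prop} (hR : PrimrecRel R) :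
    REPred fun a => ∃ b, R a b := by
  classical
  have h1 : Primrec fun p : α × ℕ =>
      (Encodable.decode (α := β) p.2).any fun b => decide (R p.1 b) := by
    have := Primrec.option_casesOn (Primrec.decode.comp Primrec.snd) (Primrec.const false)
      (hR.decide.comp (Primrec.fst.comp Primrec.fst) Primrec.snd :
        Primrec fun q : (α × ℕ) × β => decide (R q.1.1 q.2)).to₂
    refine this.of_eq fun p => ?_
    cases (Encodable.decode p.2 : Option β) <;> rfl
  have h2 := (Partrec.rfind (p := fun a n => Part.some
    ((Encodable.decode (α := β) n).any fun b => decide (R a b))) h1.to_comp.partrec).dom_re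
  refine h2.of_eq fun a => ?_
  refine Nat.rfind_dom.trans ?_
  constructor
  · rintro ⟨n, hn, -⟩
    simp only [Part.mem_some_iff] at hn
    cases hd : (Encodable.decode n : Option β) with
    | none => simp [hd] at hn
    | some b => exact ⟨b, by simpa [hd] using hn⟩
  · rintro ⟨b, hb⟩
    exact ⟨Encodable.encode b, by simp [hb], fun _ => trivial⟩

end Primrec

/-! ### The abstract system -/

section Abstract

variable {K : Type*}

/-- A constraint together with a mark: `false` for a constraint of the goal, `true` for one that
has been introduced into the store. -/
abbrev Item (K : Type*) := Bool × Constraint K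

/-- Substitution in the constraint of an item; the mark is kept. -/
def Item.subst (σ : ℕ → Term K) (x : Item K) : Item K := (x.1, x.2.subst σ)

/-- A finite list of terms as a substitution: it replaces the variable `v` by the entry of index
`v`, and fixes `v` if there is none. -/
def ofList (l : List (Term K)) (v : ℕ) : Term K := l[v]?.getD (.var v)

/-- The substitution that replaces the variable `x` by `u`. -/
def single (x : ℕ) (u : Term K) : List (Term K) := (List.range x).map .var ++ [u]

/-- A most general unifier of the two sides of an equation, if they are unifiable. -/
def Eqn.mgu (e : Eqn K) : List (Term K) :=
  match e.lhs, e.rhs with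
  | .var x, u => single x u
  | .const a, .var x => single x (.const a)
  | .const _, .const _ => []

/-- The instance of the atom `a` under `σ`, as an element of the store. -/
def storeItem (σ : ℕ → Term K) (a : Atom K) : Item K := (true, .user (a.subst σ))

/-- The instance of the constraint `c` under `σ`, as an element of the goal. -/
def goalItem (σ : ℕ → Term K) (c : Constraint K) : Item K := (false, c.subst σ)

/-- A transition of the abstract system: the items that it does not consume, and either the goal
constraint that is solved or introduced, or the rule that is applied with its matching
substitution. -/
abbrev Transition (K : Type*) := List (Item K) × (Constraint K ⊕ Rule K × List (Term K))

namespace Transition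

/-- The state before the transition. -/
def pre (w : Transition K) : List (Item K) :=
  match w.2 with
  | .inl c => (false, c) :: w.1
  | .inr (r, θ) => (r.kept ++ r.removed).map (storeItem (ofList θ)) ++ w.1

/-- The state after the transition. -/
def post (w : Transition K) : List (Item K) :=
  match w.2 with
  | .inl (.user a) => (true, .user a) :: w.1
  | .inl (.builtin e) => w.1.map (Item.subst (ofList e.mgu))
  | .inr (r, θ) =>
    r.body.map (goalItem (ofList θ)) ++ (r.kept.map (storeItem (ofList θ)) ++ w.1)

/-- An equation can be solved if it is unifiable, a rule applied if its guard is trivial. -/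
def Valid (P : Program K) (w : Transition K) : Prop :=
  match w.2 with
  | .inl (.user _) => True
  | .inl (.builtin e) => e.lhs.subst (ofList e.mgu) = e.rhs.subst (ofList e.mgu)
  | .inr (r, θ) => r ∈ P ∧
    ∀ e ∈ r.guard, e.lhs.subst (ofList θ) = e.rhs.subst (ofList θ)

end Transition

variable [Primcodable K]

theorem primrec_ofList : Primrec₂ (ofList : List (Term K) → ℕ → Term K) :=
  Primrec.option_getD.comp₂ Primrec.list_getElem? (primrec_termVar.comp Primrec.snd).to₂

theorem primrec_single : Primrec₂ (single : ℕ → Term K → List (Term K)) :=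
  Primrec.list_append.comp
    (Primrec.list_map (Primrec.list_range.comp Primrec.fst) (primrec_termVar.comp Primrec.snd).to₂)
    (Primrec.list_cons.comp Primrec.snd (Primrec.const []))

theorem primrec_mgu : Primrec (Eqn.mgu : Eqn K → List (Term K)) := by
  have h1 : Primrec₂ fun (e : Eqn K) (x : ℕ) => single x e.rhs :=
    primrec_single.comp Primrec.snd (primrec_eqn_rhs.comp Primrec.fst)
  have h2 : Primrec₂ fun (e : Eqn K) (x : ℕ) => single x e.lhs :=
    primrec_single.comp Primrec.snd (primrec_eqn_lhs.comp Primrec.fst)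
  refine (primrec_term_casesOn primrec_eqn_lhs h1
    (primrec_term_casesOn (primrec_eqn_rhs.comp Primrec.fst)
      (h2.comp (Primrec.fst.comp Primrec.fst) Primrec.snd).to₂
      (Primrec.const []).to₂).to₂).of_eq ?_
  rintro ⟨l, r⟩
  cases l <;> cases r <;> rfl

theorem primrec_item_subst {α : Type*} [Primcodable α] {θ : α → ℕ → Term K} (hθ : Primrec₂ θ) :
    Primrec₂ fun a (x : Item K) => x.subst (θ a) :=
  (Primrec.fst.comp Primrec.snd).pair
    ((primrec_constraint_subst hθ).comp Primrec.fst (Primrec.snd.comp Primrec.snd))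

theorem primrec_storeItem {α : Type*} [Primcodable α] {θ : α → ℕ → Term K} (hθ : Primrec₂ θ) :
    Primrec₂ fun a (c : Atom K) => storeItem (θ a) c :=
  (Primrec.const true).pair (primrec_constraint_user.comp (primrec_atom_subst hθ))

theorem primrec_goalItem {α : Type*} [Primcodable α] {θ : α → ℕ → Term K} (hθ : Primrec₂ θ) :
    Primrec₂ fun a (c : Constraint K) => goalItem (θ a) c :=
  (Primrec.const false).pair (primrec_constraint_subst hθ)

theorem primrec_pre : Primrec (Transition.pre : Transition K → List (Item K)) := by
  have hr : Primrec fun p : Transition K × (Rule K × List (Term K)) => p.2.1 :=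
    Primrec.fst.comp Primrec.snd
  have hθ : Primrec₂ fun p : Transition K × (Rule K × List (Term K)) => ofList p.2.2 :=
    (primrec_ofList.comp (Primrec.snd.comp (Primrec.snd.comp Primrec.fst)) Primrec.snd).to₂
  refine (Primrec.sumCasesOn Primrec.snd
    (Primrec.list_cons.comp ((Primrec.const false).pair Primrec.snd)
      (Primrec.fst.comp Primrec.fst)).to₂
    (Primrec.list_append.comp
      (Primrec.list_map (Primrec.list_append.comp (primrec_rule_kept.comp hr)
        (primrec_rule_removed.comp hr)) (primrec_storeItem hθ))
      (Primrec.fst.comp Primrec.fst)).to₂).of_eq ?_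
  rintro ⟨F, c | ⟨r, θ⟩⟩ <;> rfl

theorem primrec_post : Primrec (Transition.post : Transition K → List (Item K)) := by
  have hr : Primrec fun p : Transition K × (Rule K × List (Term K)) => p.2.1 :=
    Primrec.fst.comp Primrec.snd
  have hθ : Primrec₂ fun p : Transition K × (Rule K × List (Term K)) => ofList p.2.2 :=
    (primrec_ofList.comp (Primrec.snd.comp (Primrec.snd.comp Primrec.fst)) Primrec.snd).to₂
  have hm : Primrec₂ fun p : (Transition K × Constraint K) × Eqn K => ofList p.2.mgu :=
    (primrec_ofList.comp (primrec_mgu.comp (Primrec.snd.comp Primrec.fst)) Primrec.snd).to₂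
  refine (Primrec.sumCasesOn Primrec.snd
    (primrec_constraint_casesOn Primrec.snd
      (Primrec.list_cons.comp
        ((Primrec.const true).pair (primrec_constraint_user.comp Primrec.snd))
        (Primrec.fst.comp (Primrec.fst.comp Primrec.fst))).to₂
      (Primrec.list_map (Primrec.fst.comp (Primrec.fst.comp Primrec.fst))
        (primrec_item_subst hm)).to₂).to₂
    (Primrec.list_append.comp
      (Primrec.list_map (primrec_rule_body.comp hr) (primrec_goalItem hθ))
      (Primrec.list_append.comp
        (Primrec.list_map (primrec_rule_kept.comp hr) (primrec_storeItem hθ))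
        (Primrec.fst.comp Primrec.fst))).to₂).of_eq ?_
  rintro ⟨F, (a | e) | ⟨r, θ⟩⟩ <;> rfl

theorem primrecRel_valid :
    PrimrecRel (Transition.Valid : Program K → Transition K → Prop) := by
  classical
  -- triviality of a conjunction of equations under a substitution
  have htriv : PrimrecRel fun (θ : List (Term K)) (g : List (Eqn K)) =>
      ∀ e ∈ g, e.lhs.subst (ofList θ) = e.rhs.subst (ofList θ) := by
    have h : PrimrecRel fun (e : Eqn K) (θ : List (Term K)) =>
        e.lhs.subst (ofList θ) = e.rhs.subst (ofList θ) :=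
      Primrec.eq.comp
        ((primrec_term_subst primrec_ofList).comp Primrec.snd (primrec_eqn_lhs.comp Primrec.fst))
        ((primrec_term_subst primrec_ofList).comp Primrec.snd (primrec_eqn_rhs.comp Primrec.fst))
    exact h.forall_mem_list.comp Primrec.snd Primrec.fst
  have hmem : PrimrecRel fun (P : Program K) (r : Rule K) => r ∈ P := by
    have h : PrimrecRel fun a b : Rule K => a = b := Primrec.eq
    exact h.exists_mem_list.of_eq fun P r => by simp
  have htriv' := htriv.decide
  refine Primrec.primrecPred (p := fun q : Program K × Transition K => q.2.Valid q.1)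
    ((Primrec.sumCasesOn (Primrec.snd.comp Primrec.snd)
    (primrec_constraint_casesOn Primrec.snd (Primrec.const true).to₂
      (htriv'.comp (primrec_mgu.comp Primrec.snd)
        (Primrec.list_cons.comp Primrec.snd (Primrec.const []))).to₂).to₂
    (Primrec.and.comp
      (hmem.decide.comp (Primrec.fst.comp Primrec.fst) (Primrec.fst.comp Primrec.snd))
      (htriv'.comp (Primrec.snd.comp Primrec.snd)
        (primrec_rule_guard.comp (Primrec.fst.comp Primrec.snd)))).to₂).of_eq ?_)
  rintro ⟨P, F, (a | e) | ⟨r, θ⟩⟩ <;>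
    refine Bool.eq_iff_iff.2 (Iff.trans ?_ decide_eq_true_iff.symm) <;> simp [Transition.Valid]

/-- A certificate of non-termination: a finite set of transitions, one of which is enabled in the
initial state, and after each of which one of them is enabled. -/
def Certificate (σ : ℕ → Term K) (P : Program K) (G : Goal K) (T : List (Transition K)) : Prop :=
  (∃ w ∈ T, w.pre.Subperm (G.map (goalItem σ))) ∧
    ∀ w ∈ T, w.Valid P ∧ ∃ w' ∈ T, w'.pre.Subperm w.post

theorem rePred_exists_certificate {σ : ℕ → Term K} (hσ : Primrec σ) :
    REPred fun p : Program K × Goal K => ∃ T, Certificate σ p.1 p.2 T := by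
  apply rePred_exists
  have h1 : PrimrecRel fun (T : List (Transition K)) (l : List (Item K)) =>
      ∃ w ∈ T, w.pre.Subperm l :=
    PrimrecRel.exists_mem_list (R := fun (w : Transition K) l => w.pre.Subperm l)
      (primrecRel_subperm.comp (primrec_pre.comp Primrec.fst) Primrec.snd)
  have h2 : PrimrecRel fun (T : List (Transition K)) (q : Program K × List (Transition K)) =>
      ∀ w ∈ T, w.Valid q.1 ∧ ∃ w' ∈ q.2, w'.pre.Subperm w.post := by
    apply PrimrecRel.forall_mem_list
      (R := fun (w : Transition K) (q : Program K × List (Transition K)) =>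
        w.Valid q.1 ∧ ∃ w' ∈ q.2, w'.pre.Subperm w.post)
    exact (primrecRel_valid.comp (Primrec.fst.comp Primrec.snd) Primrec.fst).and
      (h1.comp (Primrec.snd.comp Primrec.snd) (primrec_post.comp Primrec.fst))
  have hG : Primrec fun G : Goal K => G.map (goalItem σ) :=
    Primrec.list_map Primrec.id
      ((primrec_goalItem (θ := fun _ : Goal K => σ) (hσ.comp Primrec.snd).to₂))
  exact (h1.comp Primrec.snd (hG.comp (Primrec.snd.comp Primrec.fst))).and
    (h2.comp Primrec.snd ((Primrec.fst.comp Primrec.fst).pair Primrec.snd))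

end Abstract

section Simulation

variable {K : Type*}

/-! ### Substitutions and valuations -/

theorem Term.val_subst (θ : ℕ → Term K) (μ : ℕ → K) (t : Term K) :
    (t.subst θ).val μ = t.val fun v => (θ v).val μ := by
  cases t <;> rfl

theorem Term.subst_subst (θ σ : ℕ → Term K) (t : Term K) :
    (t.subst θ).subst σ = t.subst fun v => (θ v).subst σ := by
  cases t <;> rfl

theorem Term.val_congr {ν ν' : ℕ → K} {t : Term K} (h : ∀ v ∈ t.vars, ν v = ν' v) :
    t.val ν = t.val ν' := by
  cases t with
  | var v => exact h v (by simp [Term.vars])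
  | const k => rfl

theorem Term.subst_congr {θ σ : ℕ → Term K} {t : Term K} (h : ∀ v ∈ t.vars, θ v = σ v) :
    t.subst θ = t.subst σ := by
  cases t with
  | var v => exact h v (by simp [Term.vars])
  | const k => rfl

theorem Term.vars_rename (ρ : ℕ → ℕ) (t : Term K) :
    (t.subst fun v => .var (ρ v)).vars = t.vars.map ρ := by
  cases t <;> rfl

theorem Atom.subst_subst (θ σ : ℕ → Term K) (a : Atom K) :
    (a.subst θ).subst σ = a.subst fun v => (θ v).subst σ := by
  simp [Atom.subst, Term.subst_subst]

theorem Atom.subst_congr {θ σ : ℕ → Term K} {a : Atom K} (h : ∀ v ∈ a.vars, θ v = σ v) :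
    a.subst θ = a.subst σ := by
  simp only [Atom.subst, Atom.mk.injEq, true_and]
  exact List.map_congr_left fun t ht => Term.subst_congr fun v hv =>
    h v (List.mem_flatMap.2 ⟨t, ht, hv⟩)

theorem Atom.vars_rename (ρ : ℕ → ℕ) (a : Atom K) :
    (a.subst fun v => .var (ρ v)).vars = a.vars.map ρ := by
  simp [Atom.vars, Atom.subst, List.flatMap_map, List.map_flatMap, Term.vars_rename]

theorem Atom.mem_args_subst_of_mem_vars {θ : ℕ → Term K} {a : Atom K} {v : ℕ} (h : v ∈ a.vars) :
    θ v ∈ (a.subst θ).args := by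
  obtain ⟨t, ht, hv⟩ := List.mem_flatMap.1 h
  refine List.mem_map.2 ⟨t, ht, ?_⟩
  cases t with
  | var w =>
    obtain rfl : v = w := by simpa [Term.vars] using hv
    rfl
  | const k => simp [Term.vars] at hv

theorem Constraint.subst_subst (θ σ : ℕ → Term K) (c : Constraint K) :
    (c.subst θ).subst σ = c.subst fun v => (θ v).subst σ := by
  cases c <;> simp [Constraint.subst, Atom.subst_subst, Eqn.subst, Term.subst_subst]

theorem Constraint.subst_congr {θ σ : ℕ → Term K} {c : Constraint K}
    (h : ∀ v ∈ c.vars, θ v = σ v) : c.subst θ = c.subst σ := by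
  cases c with
  | user a => exact congrArg _ (Atom.subst_congr h)
  | builtin e =>
    simp only [Constraint.subst, Eqn.subst, Constraint.builtin.injEq, Eqn.mk.injEq]
    exact ⟨Term.subst_congr fun v hv => h v (List.mem_append_left _ hv),
      Term.subst_congr fun v hv => h v (List.mem_append_right _ hv)⟩

theorem Rule.headVars_rename (ρ : ℕ → ℕ) (r : Rule K) :
    (r.rename ρ).headVars = r.headVars.map ρ := by
  simp [Rule.headVars, Rule.rename, List.flatMap_map, List.map_flatMap, Atom.vars_rename]

theorem holds_congr {ν ν' : ℕ → K} {B : Multiset (Eqn K)}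
    (h : ∀ e ∈ B, ∀ v ∈ e.vars, ν v = ν' v) (hB : Holds ν B) : Holds ν' B := by
  intro e he
  rw [← Term.val_congr fun v hv => h e he v (List.mem_append_left _ hv),
    ← Term.val_congr fun v hv => h e he v (List.mem_append_right _ hv)]
  exact hB e he

theorem holds_add {ν : ℕ → K} {B C : Multiset (Eqn K)} :
    Holds ν (B + C) ↔ Holds ν B ∧ Holds ν C := by
  simp only [Holds, Multiset.mem_add, or_imp, forall_and]

theorem holds_cons {ν : ℕ → K} {e : Eqn K} {B : Multiset (Eqn K)} :
    Holds ν (e ::ₘ B) ↔ e.lhs.val ν = e.rhs.val ν ∧ Holds ν B := by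
  simp [Holds]

theorem holds_substEqns {ν : ℕ → K} {vs : List ℕ} {θ : ℕ → Term K} :
    Holds ν (substEqns vs θ) ↔ ∀ v ∈ vs, ν v = (θ v).val ν := by
  simp [Holds, substEqns, Term.val]

theorem Term.eq_of_forall_val [Nontrivial K] {s t : Term K}
    (h : ∀ μ : ℕ → K, s.val μ = t.val μ) : s = t := by
  classical
  obtain ⟨a, b, hab⟩ := exists_pair_ne K
  cases s with
  | var x =>
    cases t with
    | var y =>
      by_contra hne
      have hxy : y ≠ x := fun e => hne (e ▸ rfl)
      exact hab (by simpa [Term.val, hxy] using (h (Function.update (fun _ => b) x a)))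
    | const k =>
      obtain ⟨c, hc⟩ := exists_ne k
      exact absurd (h fun _ => c) hc
  | const k =>
    cases t with
    | var y =>
      obtain ⟨c, hc⟩ := exists_ne k
      exact absurd (h fun _ => c).symm hc
    | const k' => exact congrArg _ (h fun _ => a)

/-! ### Unification -/

theorem ofList_single (x : ℕ) (u : Term K) (v : ℕ) :
    ofList (single x u) v = if v = x then u else .var v := by
  unfold ofList single
  rcases lt_trichotomy v x with h | rfl | h
  · rw [List.getElem?_append_left (by simpa using h)]
    simp [h, h.ne]
  · simp
  · rw [List.getElem?_eq_none (by simp; omega)]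
    simp [h.ne']

theorem Term.subst_single_self (x : ℕ) (u : Term K) : u.subst (ofList (single x u)) = u := by
  cases u with
  | var y =>
    rw [Term.subst, ofList_single]
    split_ifs <;> rfl
  | const k => rfl

theorem Eqn.mgu_unifies {e : Eqn K} {ν : ℕ → K} (h : e.lhs.val ν = e.rhs.val ν) :
    e.lhs.subst (ofList e.mgu) = e.rhs.subst (ofList e.mgu) := by
  obtain ⟨l, r⟩ := e
  cases l with
  | var x =>
    simp only [Eqn.mgu, Term.subst_single_self]
    simp [Term.subst, ofList_single]
  | const a =>
    cases r with
    | var x => simp [Eqn.mgu, Term.subst, ofList_single]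
    | const b => exact congrArg Term.const h

/-- Every solution of an equation factors through its most general unifier. -/
theorem Eqn.val_mgu {e : Eqn K} {ν : ℕ → K} (h : e.lhs.val ν = e.rhs.val ν) (v : ℕ) :
    (ofList e.mgu v).val ν = ν v := by
  obtain ⟨l, r⟩ := e
  cases l with
  | var x =>
    simp only [Eqn.mgu, ofList_single]
    split_ifs with hv
    · exact hv ▸ h.symm
    · rfl
  | const a =>
    cases r with
    | var x =>
      simp only [Eqn.mgu, ofList_single]
      split_ifs with hv
      · exact hv ▸ h
      · rfl
    | const b => rfl

/-! ### Solved forms of the built-in store -/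

/-- The substitution `σ` parametrises the solutions of `B`. Over a single constant, where the
equality of any two terms is valid, `σ` has to be ground in addition; thus in all cases entailed
equality amounts to syntactic equality of the instances under `σ`. -/
def SolvedForm (B : Multiset (Eqn K)) (σ : ℕ → Term K) : Prop :=
  (∀ ν : ℕ → K, Holds ν B ↔ ∃ μ : ℕ → K, ∀ v, ν v = (σ v).val μ) ∧
    (Nontrivial K ∨ ∀ v, ∃ k, σ v = .const k)

namespace SolvedForm

variable {B : Multiset (Eqn K)} {σ : ℕ → Term K}

theorem holds (h : SolvedForm B σ) (μ : ℕ → K) : Holds (fun v => (σ v).val μ) B :=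
  (h.1 _).2 ⟨μ, fun _ => rfl⟩

theorem entailsEq_iff (h : SolvedForm B σ) {s t : Term K} :
    EntailsEq B s t ↔ s.subst σ = t.subst σ := by
  constructor
  · intro hst
    have hval : ∀ μ : ℕ → K, (s.subst σ).val μ = (t.subst σ).val μ := fun μ => by
      rw [Term.val_subst, Term.val_subst]
      exact hst _ (h.holds μ)
    rcases h.2 with hK | hσ
    · exact Term.eq_of_forall_val hval
    · have hg : ∀ t : Term K, ∃ k, t.subst σ = .const k := by
        rintro (v | k)
        exacts [hσ v, ⟨k, rfl⟩]
      obtain ⟨k, hk⟩ := hg s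
      obtain ⟨l, hl⟩ := hg t
      have := hval fun _ => k
      rw [hk, hl] at this ⊢
      exact congrArg _ this
  · intro hst ν hν
    obtain ⟨μ, hμ⟩ := (h.1 ν).1 hν
    have := congrArg (Term.val μ) hst
    rw [Term.val_subst, Term.val_subst] at this
    rwa [show ν = fun v => (σ v).val μ from funext hμ]

theorem entailsAtomEq_iff (h : SolvedForm B σ) {a b : Atom K} :
    EntailsAtomEq B a b ↔ a.subst σ = b.subst σ := by
  have : EntailsEq B = fun s t => s.subst σ = t.subst σ := by
    funext s t
    exact propext h.entailsEq_iff
  simp only [EntailsAtomEq, this, Atom.subst, Atom.mk.injEq]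
  rw [← List.forall₂_eq_eq_eq, List.forall₂_map_left_iff, List.forall₂_map_right_iff]

theorem rel_entailsAtomEq_iff (h : SolvedForm B σ) {s t : Multiset (Atom K)} :
    Multiset.Rel (EntailsAtomEq B) s t ↔ s.map (Atom.subst σ) = t.map (Atom.subst σ) := by
  have : EntailsAtomEq B = fun a b => a.subst σ = b.subst σ := by
    funext a b
    exact propext h.entailsAtomEq_iff
  rw [this, ← Multiset.rel_eq, Multiset.rel_map]

/-- Solving an equation composes the solved form with a most general unifier. -/
theorem solve (h : SolvedForm B σ) (e : Eqn K)
    (he : (e.subst σ).lhs.subst (ofList (e.subst σ).mgu) =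
      (e.subst σ).rhs.subst (ofList (e.subst σ).mgu)) :
    SolvedForm (e ::ₘ B) fun v => (σ v).subst (ofList (e.subst σ).mgu) := by
  refine ⟨fun ν => ?_, h.2.imp_right fun hσ v => ?_⟩
  · rw [holds_cons]
    constructor
    · rintro ⟨h1, h2⟩
      obtain ⟨μ, hμ⟩ := (h.1 ν).1 h2
      obtain rfl : ν = fun v => (σ v).val μ := funext hμ
      rw [← Term.val_subst, ← Term.val_subst] at h1
      refine ⟨μ, fun v => ?_⟩
      rw [Term.val_subst]
      exact Term.val_congr fun w _ => (Eqn.val_mgu h1 w).symm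
    · rintro ⟨μ, hμ⟩
      obtain rfl := funext hμ
      have := congrArg (Term.val μ) he
      simp only [Term.val_subst] at this ⊢
      simp only [Eqn.subst, Term.val_subst] at this
      exact ⟨this, h.holds _⟩
  · obtain ⟨k, hk⟩ := hσ v
    exact ⟨k, by simp [hk, Term.subst]⟩

open Classical in
/-- Adding the bindings `θ` of new variables `vs` extends the solved form, provided that `B` equates
each bound value with a term free of the new variables. Over a single constant `θ` is otherwise
arbitrary, and its values may contain new variables. -/
theorem apply (h : SolvedForm B σ) {vs : List ℕ} {θ : ℕ → Term K}
    (hB : ∀ e ∈ B, ∀ v ∈ e.vars, v ∉ vs)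
    (hθ : ∀ v ∈ vs, ∃ t : Term K, t.subst σ = (θ v).subst σ ∧ ∀ x ∈ t.vars, x ∉ vs) :
    SolvedForm (substEqns vs θ + B) fun v => if v ∈ vs then (θ v).subst σ else σ v := by
  refine ⟨fun ν => ?_, h.2.imp_right fun hσ v => ?_⟩
  · rw [holds_add, holds_substEqns]
    constructor
    · rintro ⟨h1, h2⟩
      obtain ⟨μ, hμ⟩ := (h.1 ν).1 h2
      refine ⟨μ, fun v => ?_⟩
      dsimp only
      split_ifs with hv
      · rw [h1 v hv, Term.val_subst]
        exact Term.val_congr fun w _ => hμ w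
      · exact hμ v
    · rintro ⟨μ, hμ⟩
      beta_reduce at hμ
      have h0 := h.holds μ
      have hagree : ∀ v, v ∉ vs → (σ v).val μ = ν v := fun v hv => by rw [hμ v, if_neg hv]
      have hνB : Holds ν B := holds_congr (fun e he v hv => hagree v (hB e he v hv)) h0
      refine ⟨fun v hv => ?_, hνB⟩
      -- `θ v` equals under `B` a term on which `ν` agrees with the solution given by `μ`
      obtain ⟨t, ht, hx⟩ := hθ v hv
      have het := h.entailsEq_iff.2 ht
      rw [← het ν hνB, hμ v, if_pos hv, ← ht, Term.val_subst]
      exact Term.val_congr fun x hxt => hagree x (hx x hxt)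
  · dsimp only
    split_ifs
    · cases θ v with
      | var w => exact hσ w
      | const k => exact ⟨k, rfl⟩
    · exact hσ v

end SolvedForm

/-- The empty built-in store has a solved form: the identity, or over a single constant the
substitution by this constant. -/
theorem exists_solvedForm_zero [Primcodable K] [Nonempty K] :
    ∃ σ : ℕ → Term K, Primrec σ ∧ SolvedForm 0 σ := by
  by_cases hK : Nontrivial K
  · exact ⟨.var, primrec_termVar, fun ν => ⟨fun _ => ⟨ν, fun _ => rfl⟩, fun _ => by simp [Holds]⟩,
      .inl hK⟩
  · have := not_nontrivial_iff_subsingleton.1 hK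
    let k := Classical.arbitrary K
    exact ⟨fun _ => .const k, Primrec.const _,
      fun ν => ⟨fun _ => ⟨ν, fun _ => Subsingleton.elim _ _⟩, fun _ => by simp [Holds]⟩,
      .inr fun _ => ⟨k, rfl⟩⟩

/-! ### Simulation of computations by abstract transitions -/

/-- The items of a goal and a store, instantiated by `σ`. -/
def items (σ : ℕ → Term K) (G : Multiset (Constraint K)) (S : Multiset (Atom K × ℕ)) :
    Multiset (Item K) :=
  G.map (goalItem σ) + S.map fun p => storeItem σ p.1

/-- The abstract state `M` represents the configuration `s`, whose built-in store has the solved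
form `σ`. -/
def Represents (σ : ℕ → Term K) (s : Config K) (M : Multiset (Item K)) : Prop :=
  SolvedForm s.builtin σ ∧ M = items σ s.goal s.store

theorem Represents.not_failed [Nonempty K] {σ : ℕ → Term K} {s : Config K}
    {M : Multiset (Item K)} (h : Represents σ s M) : ¬ s.Failed :=
  fun hf => hf ⟨_, h.1.holds fun _ => Classical.arbitrary K⟩

theorem goalItem_comp (σ τ : ℕ → Term K) (c : Constraint K) :
    goalItem (fun v => (σ v).subst τ) c = (goalItem σ c).subst τ := by
  simp [goalItem, Item.subst, Constraint.subst_subst]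

theorem storeItem_comp (σ τ : ℕ → Term K) (a : Atom K) :
    storeItem (fun v => (σ v).subst τ) a = (storeItem σ a).subst τ := by
  simp [storeItem, Item.subst, Constraint.subst, Atom.subst_subst]

theorem items_comp (σ τ : ℕ → Term K) (G : Multiset (Constraint K))
    (S : Multiset (Atom K × ℕ)) :
    items (fun v => (σ v).subst τ) G S = (items σ G S).map (Item.subst τ) := by
  simp [items, goalItem_comp, storeItem_comp]

theorem items_congr {σ σ' : ℕ → Term K} {G : Multiset (Constraint K)}
    {S : Multiset (Atom K × ℕ)} (hG : ∀ c ∈ G, ∀ v ∈ c.vars, σ v = σ' v)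
    (hS : ∀ p ∈ S, ∀ v ∈ p.1.vars, σ v = σ' v) : items σ G S = items σ' G S := by
  unfold items
  congr 1
  · exact Multiset.map_congr rfl fun c hc => by
      rw [goalItem, goalItem, Constraint.subst_congr (hG c hc)]
  · exact Multiset.map_congr rfl fun p hp => by
      rw [storeItem, storeItem, Atom.subst_congr (hS p hp)]

theorem items_cons_goal (σ : ℕ → Term K) (c : Constraint K) (G : Multiset (Constraint K))
    (S : Multiset (Atom K × ℕ)) : items σ (c ::ₘ G) S = goalItem σ c ::ₘ items σ G S := by
  simp [items]

theorem items_cons_store (σ : ℕ → Term K) (p : Atom K × ℕ) (G : Multiset (Constraint K))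
    (S : Multiset (Atom K × ℕ)) : items σ G (p ::ₘ S) = storeItem σ p.1 ::ₘ items σ G S := by
  simp [items]

theorem items_add (σ : ℕ → Term K) (G G' : Multiset (Constraint K))
    (S S' : Multiset (Atom K × ℕ)) : items σ (G + G') (S + S') = items σ G S + items σ G' S' := by
  simp only [items, Multiset.map_add]
  abel

theorem Represents.solve {σ : ℕ → Term K} {e : Eqn K} {G : Multiset (Constraint K)}
    {S : Multiset (Atom K × ℕ)} {B : Multiset (Eqn K)} {n n' : ℕ} {M : Multiset (Item K)}
    (h : Represents σ ⟨.builtin e ::ₘ G, S, B, n⟩ M)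
    (he : (e.subst σ).lhs.subst (ofList (e.subst σ).mgu) =
      (e.subst σ).rhs.subst (ofList (e.subst σ).mgu)) :
    Represents (fun v => (σ v).subst (ofList (e.subst σ).mgu)) ⟨G, S, e ::ₘ B, n'⟩
      ((items σ G S).map (Item.subst (ofList (e.subst σ).mgu))) :=
  ⟨h.1.solve e he, (items_comp ..).symm⟩

open Classical in
/-- The effect of the application of a rule: each of its variables stands for the instance of some
term of the configuration, so that a solved form after the step is obtained by instantiating the
matching substitution. -/
theorem Represents.apply {σ : ℕ → Term K} {G : Multiset (Constraint K)}
    {H₁ H₂ S : Multiset (Atom K × ℕ)} {B : Multiset (Eqn K)} {n n' : ℕ} {M : Multiset (Item K)}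
    (h : Represents σ ⟨G, H₁ + H₂ + S, B, n⟩ M) {r : Rule K} (hr : r.RangeRestricted)
    {ρ : ℕ → ℕ} {θ : ℕ → Term K} {l : List (Term K)}
    (hfresh : ∀ v ∈ (r.rename ρ).vars, v ∉ Config.vars ⟨G, H₁ + H₂ + S, B, n⟩)
    (hθ : ∀ v ∈ r.headVars, ∃ t : Term K, t.subst σ = (θ (ρ v)).subst σ ∧
      ∀ x ∈ t.vars, x ∈ Config.vars ⟨G, H₁ + H₂ + S, B, n⟩)
    (hl : ∀ v ∈ r.headVars, ofList l v = (θ (ρ v)).subst σ)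
    (hkept : H₁.map (fun p => storeItem σ p.1) = ↑(r.kept.map (storeItem (ofList l)))) :
    Represents
      (fun v => if v ∈ (r.rename ρ).headVars then (θ v).subst σ else σ v)
      ⟨↑(r.rename ρ).body + G, H₁ + S, substEqns (r.rename ρ).headVars θ + B, n'⟩
      (↑(r.body.map (goalItem (ofList l))) +
        (↑(r.kept.map (storeItem (ofList l))) + items σ G S)) := by
  have hhv : ∀ v ∈ Config.vars ⟨G, H₁ + H₂ + S, B, n⟩, v ∉ (r.rename ρ).headVars :=
    fun v hv hv' => hfresh v (by simp [Rule.vars, hv']) hv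
  refine ⟨h.1.apply (fun e he v hv => hhv v (.inr (.inr ⟨e, he, hv⟩))) ?_, ?_⟩
  · intro v hv
    rw [Rule.headVars_rename] at hv
    obtain ⟨w, hw, rfl⟩ := List.mem_map.1 hv
    obtain ⟨t, ht, hx⟩ := hθ w hw
    exact ⟨t, ht, fun x hx' => hhv x (hx x hx')⟩
  · have hbody : ((r.rename ρ).body : Multiset (Constraint K)).map (goalItem fun v =>
        if v ∈ (r.rename ρ).headVars then (θ v).subst σ else σ v) =
        ↑(r.body.map (goalItem (ofList l))) := by
      simp only [Rule.rename, Multiset.map_coe, List.map_map, Multiset.coe_eq_coe]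
      refine List.Perm.of_eq (List.map_congr_left fun c hc => ?_)
      simp only [Function.comp, goalItem, Constraint.subst_subst]
      refine congrArg _ (Constraint.subst_congr fun v hv => ?_)
      have hv' : v ∈ r.headVars := hr v (.inl (List.mem_flatMap.2 ⟨c, hc, hv⟩))
      have : ρ v ∈ (r.rename ρ).headVars := by
        rw [Rule.headVars_rename]
        exact List.mem_map_of_mem hv'
      rw [hl v hv']
      exact if_pos this
    have hrest : items (fun v => if v ∈ (r.rename ρ).headVars then (θ v).subst σ else σ v) G
        (H₁ + S) = items σ G (H₁ + S) := by
      refine items_congr (fun c hc v hv => if_neg (hhv v (.inl ⟨c, hc, hv⟩)))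
        fun p hp v hv => if_neg (hhv v (.inr (.inl ⟨p, ?_, hv⟩)))
      simp only [Multiset.mem_add] at hp ⊢
      tauto
    rw [← hkept, ← hbody]
    have := items_add (fun v => if v ∈ (r.rename ρ).headVars then (θ v).subst σ else σ v)
      ↑(r.rename ρ).body G 0 (H₁ + S)
    rw [zero_add] at this
    rw [this, hrest]
    simp only [items, Multiset.map_add, Multiset.map_zero, add_zero]
    abel

/-- A renamed head variable is bound by the matching to an argument of a constraint in the
store. -/
theorem exists_arg_of_matching {σ : ℕ → Term K} {H : Multiset (Atom K × ℕ)} {A : List (Atom K)}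
    {θ : ℕ → Term K} (h : H.map (fun p => p.1.subst σ) = ↑(A.map (Atom.subst θ))) {v : ℕ}
    (hv : v ∈ A.flatMap Atom.vars) :
    ∃ p ∈ H, ∃ t ∈ p.1.args, t.subst σ = θ v := by
  obtain ⟨a, ha, hva⟩ := List.mem_flatMap.1 hv
  have : a.subst θ ∈ H.map fun p => p.1.subst σ := by
    rw [h]
    exact Multiset.mem_coe.2 (List.mem_map_of_mem ha)
  obtain ⟨p, hp, e⟩ := Multiset.mem_map.1 this
  have hm := Atom.mem_args_subst_of_mem_vars (θ := θ) hva
  rw [← e] at hm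
  obtain ⟨t, ht, e'⟩ := List.mem_map.1 hm
  exact ⟨p, hp, t, ht, e'⟩

theorem map_storeItem_eq_iff {σ θ : ℕ → Term K} {H : Multiset (Atom K × ℕ)} {A : List (Atom K)} :
    H.map (fun p => storeItem σ p.1) = ↑(A.map (storeItem θ)) ↔
      H.map (fun p => p.1.subst σ) = ↑(A.map (Atom.subst θ)) := by
  have hinj : Function.Injective fun a : Atom K => ((true, .user a) : Item K) := by
    intro a b h
    simpa using h
  rw [← (Multiset.map_injective hinj).eq_iff]
  rw [Multiset.map_map, Multiset.map_coe, List.map_map]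
  rfl

theorem exists_ofList_eq (f : ℕ → Term K) (vs : List ℕ) :
    ∃ l, ∀ v ∈ vs, ofList l v = f v := by
  refine ⟨(List.range (vs.sum + 1)).map f, fun v hv => ?_⟩
  have : v < vs.sum + 1 := Nat.lt_succ_of_le (List.le_sum_of_mem hv)
  simp [ofList, this]

/-- Every step that does not fail is simulated by a transition. -/
theorem Represents.exists_transition {σ : ℕ → Term K} {s s' : Config K} {M : Multiset (Item K)}
    (h : Represents σ s M) {P : Program K} (hP : P.RangeRestricted) (hs : Step P s s')
    (hf : ¬ s'.Failed) :
    ∃ w : Transition K, w.Valid P ∧ M = ↑w.pre ∧ ∃ σ', Represents σ' s' ↑w.post := by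
  cases hs with
  | solve e G S B n =>
    have hv : (e.subst σ).lhs.subst (ofList (e.subst σ).mgu) =
        (e.subst σ).rhs.subst (ofList (e.subst σ).mgu) := by
      obtain ⟨ν, hν⟩ := not_not.1 hf
      obtain ⟨h1, h2⟩ := holds_cons.1 hν
      obtain ⟨μ, hμ⟩ := (h.1.1 ν).1 h2
      obtain rfl := funext hμ
      rw [← Term.val_subst, ← Term.val_subst] at h1
      exact Eqn.mgu_unifies h1
    refine ⟨((items σ G S).toList, .inl (.builtin (e.subst σ))), hv, ?_,
      fun v => (σ v).subst (ofList (e.subst σ).mgu), ?_⟩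
    · rw [h.2, items_cons_goal]
      simp [Transition.pre, goalItem, Constraint.subst, ← Multiset.cons_coe]
    · convert h.solve hv using 1
      simp [Transition.post, ← Multiset.map_coe]
  | introduce a G S B n =>
    refine ⟨((items σ G S).toList, .inl (.user (a.subst σ))), trivial, ?_, σ, h.1, ?_⟩
    · rw [h.2, items_cons_goal]
      simp [Transition.pre, goalItem, Constraint.subst, ← Multiset.cons_coe]
    · rw [items_cons_store]
      simp [Transition.post, storeItem, ← Multiset.cons_coe]
  | apply G H₁ H₂ S B n r r' ρ θ mem inj ren fresh mk mr hg =>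
    subst ren
    have hr := hP r mem
    obtain ⟨l, hl⟩ := exists_ofList_eq (fun v => (θ (ρ v)).subst σ) r.headVars
    -- in terms of the original rule, the heads are matched by `ofList l`
    have hmatch : ∀ (H : Multiset (Atom K × ℕ)) (A : List (Atom K)),
        (∀ a ∈ A, ∀ v ∈ a.vars, v ∈ r.headVars) →
        Multiset.Rel (EntailsAtomEq B) (H.map Prod.fst)
          ↑((A.map (Atom.subst fun v => .var (ρ v))).map (Atom.subst θ)) →
        H.map (fun p => p.1.subst σ) = ↑(A.map (Atom.subst (ofList l))) := by
      intro H A hA hrel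
      have := h.1.rel_entailsAtomEq_iff.1 hrel
      rw [Multiset.map_map] at this
      refine Eq.trans this ?_
      rw [Multiset.map_coe, List.map_map, List.map_map]
      refine congrArg _ (List.map_congr_left fun a ha => ?_)
      simp only [Function.comp, Atom.subst_subst]
      exact Atom.subst_congr fun v hv => (hl v (hA a ha v hv)).symm
    have hk := hmatch H₁ r.kept (fun a ha v hv => List.mem_flatMap.2
      ⟨a, List.mem_append_left _ ha, hv⟩) mk
    have hrm := hmatch H₂ r.removed (fun a ha v hv => List.mem_flatMap.2
      ⟨a, List.mem_append_right _ ha, hv⟩) mr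
    have hθ : ∀ v ∈ r.headVars, ∃ t : Term K, t.subst σ = (θ (ρ v)).subst σ ∧
        ∀ x ∈ t.vars, x ∈ Config.vars ⟨G, H₁ + H₂ + S, B, n⟩ := by
      intro v hv
      have : (H₁ + H₂).map (fun p => p.1.subst σ) =
          ↑((r.kept ++ r.removed).map (Atom.subst (ofList l))) := by
        rw [Multiset.map_add, hk, hrm, List.map_append, Multiset.coe_add]
      obtain ⟨p, hp, t, ht, e⟩ := exists_arg_of_matching this hv
      exact ⟨t, e.trans (hl v hv), fun x hx => .inr (.inl
        ⟨p, Multiset.mem_add.2 (.inl hp), List.mem_flatMap.2 ⟨t, ht, hx⟩⟩)⟩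
    have hguard : ∀ e ∈ r.guard, e.lhs.subst (ofList l) = e.rhs.subst (ofList l) := by
      intro e he
      have hvars : ∀ v ∈ e.vars, v ∈ r.headVars := fun v hv =>
        hr v (.inr (List.mem_flatMap.2 ⟨e, he, hv⟩))
      have hsub : ∀ t : Term K, (∀ v ∈ t.vars, v ∈ e.vars) →
          t.subst (ofList l) = (t.subst fun v => θ (ρ v)).subst σ := by
        intro t ht
        rw [Term.subst_subst]
        exact Term.subst_congr fun v hv => hl v (hvars v (ht v hv))
      rw [hsub _ fun v hv => List.mem_append_left _ hv,
        hsub _ fun v hv => List.mem_append_right _ hv]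
      refine h.1.entailsEq_iff.1 fun ν hν => ?_
      obtain ⟨ν', hV, hν'⟩ := hg ν hν
      obtain ⟨hν1, hν2⟩ := holds_add.1 hν'
      rw [holds_substEqns] at hν1
      have hνB : Holds ν' B := holds_congr (fun e he v hv =>
        (hV v (.inr (.inr ⟨e, he, hv⟩))).symm) hν
      -- on the head variables, the witness `ν'` of the guard agrees with `θ` evaluated by `ν`
      have hagree : ∀ v ∈ r.headVars, (θ (ρ v)).val ν = ν' (ρ v) := by
        intro v hv
        obtain ⟨t, ht, hx⟩ := hθ v hv
        have het := h.1.entailsEq_iff.2 ht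
        rw [hν1 (ρ v) (by rw [Rule.headVars_rename]; exact List.mem_map_of_mem hv),
          ← het ν hν, ← het ν' hνB]
        exact Term.val_congr fun x hxt => (hV x (hx x hxt)).symm
      have hval : ∀ t : Term K, (∀ v ∈ t.vars, v ∈ e.vars) →
          (t.subst fun v => θ (ρ v)).val ν = (t.subst fun v => .var (ρ v)).val ν' := by
        intro t ht
        rw [Term.val_subst, Term.val_subst]
        exact Term.val_congr fun v hv => hagree v (hvars v (ht v hv))
      rw [hval _ fun v hv => List.mem_append_left _ hv,
        hval _ fun v hv => List.mem_append_right _ hv]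
      exact hν2 _ (Multiset.mem_coe.2 (List.mem_map_of_mem he))
    refine ⟨((items σ G S).toList, .inr (r, l)), ⟨mem, hguard⟩, ?_, _,
      Eq.mp (congrArg (Represents _ _) ?_)
        (h.apply hr fresh hθ hl (map_storeItem_eq_iff.2 hk))⟩
    · rw [h.2]
      simp only [Transition.pre, items, Multiset.map_add, map_storeItem_eq_iff.2 hk,
        map_storeItem_eq_iff.2 hrm, List.map_append, ← Multiset.coe_add, Multiset.coe_toList]
      abel
    · simp [Transition.post, ← Multiset.coe_add]

theorem exists_add_of_map_eq_add {α β : Type*} {f : α → β} {s : Multiset α} {t u : Multiset β}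
    (h : s.map f = t + u) : ∃ s₁ s₂, s = s₁ + s₂ ∧ s₁.map f = t ∧ s₂.map f = u := by
  induction t using Multiset.induction_on generalizing s with
  | empty => exact ⟨0, s, by simp, rfl, by simpa using h⟩
  | cons b t ih =>
    rw [Multiset.cons_add] at h
    obtain ⟨a, ha, rfl⟩ := Multiset.mem_map.1 (h ▸ Multiset.mem_cons_self b (t + u))
    obtain ⟨s, rfl⟩ := Multiset.exists_cons_of_mem ha
    rw [Multiset.map_cons, Multiset.cons_inj_right] at h
    obtain ⟨s₁, s₂, rfl, rfl, rfl⟩ := ih h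
    exact ⟨a ::ₘ s₁, s₂, by simp, by simp, rfl⟩

theorem exists_forall_lt_of_multiset {α : Type*} (s : Multiset α) (f : α → List ℕ) :
    ∃ N, ∀ a ∈ s, ∀ v ∈ f a, v < N := by
  refine ⟨(s.map fun a => (f a).sum).sum + 1, fun a ha v hv => Nat.lt_succ_of_le ?_⟩
  exact (List.le_sum_of_mem hv).trans
    (Multiset.single_le_sum (fun _ _ => Nat.zero_le _) _ (Multiset.mem_map_of_mem _ ha))

theorem Config.exists_vars_lt (s : Config K) : ∃ N, ∀ v ∈ s.vars, v < N := by
  obtain ⟨N₁, h₁⟩ := exists_forall_lt_of_multiset s.goal Constraint.vars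
  obtain ⟨N₂, h₂⟩ := exists_forall_lt_of_multiset s.store fun p => p.1.vars
  obtain ⟨N₃, h₃⟩ := exists_forall_lt_of_multiset s.builtin Eqn.vars
  refine ⟨N₁ + N₂ + N₃, ?_⟩
  rintro v (⟨c, hc, hv⟩ | ⟨p, hp, hv⟩ | ⟨e, he, hv⟩)
  · have := h₁ c hc v hv; omega
  · have := h₂ p hp v hv; omega
  · have := h₃ e he v hv; omega

/-- Every transition from a state that represents a configuration is realised by a step. -/
theorem Represents.exists_step {σ : ℕ → Term K} {s : Config K} {P : Program K}
    {w : Transition K} (h : Represents σ s ↑w.pre) (hP : P.RangeRestricted) (hw : w.Valid P) :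
    ∃ s' σ', Step P s s' ∧ Represents σ' s' ↑w.post := by
  classical
  obtain ⟨G, S, B, n⟩ := s
  -- a goal item of the state comes from the goal of the configuration
  have hgoal : ∀ (c : Constraint K) (F : List (Item K)),
      ((false, c) ::ₘ (F : Multiset (Item K))) = items σ G S →
      ∃ d G', G = d ::ₘ G' ∧ d.subst σ = c ∧ (F : Multiset (Item K)) = items σ G' S := by
    intro c F e
    have hmem : (false, c) ∈ items σ G S := e ▸ Multiset.mem_cons_self _ _
    rcases Multiset.mem_add.1 hmem with hm | hm
    · obtain ⟨d, hd, e'⟩ := Multiset.mem_map.1 hm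
      obtain ⟨G', rfl⟩ := Multiset.exists_cons_of_mem hd
      rw [items_cons_goal, e', Multiset.cons_inj_right] at e
      exact ⟨d, G', rfl, congrArg Prod.snd e', e⟩
    · obtain ⟨p, -, e'⟩ := Multiset.mem_map.1 hm
      exact absurd (congrArg Prod.fst e') (by simp [storeItem])
  obtain ⟨F, (a | e) | ⟨r, l⟩⟩ := w
  · obtain ⟨d, G', rfl, hd, hF⟩ := hgoal (.user a) F h.2
    cases d with
    | builtin e => simp [Constraint.subst] at hd
    | user b =>
      obtain rfl : b.subst σ = a := by simpa [Constraint.subst] using hd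
      refine ⟨_, σ, .introduce b G' S B n, h.1, ?_⟩
      rw [items_cons_store, ← hF]
      rfl
  · obtain ⟨d, G', rfl, hd, hF⟩ := hgoal (.builtin e) F h.2
    cases d with
    | user b => simp [Constraint.subst] at hd
    | builtin e' =>
      obtain rfl : e'.subst σ = e := by simpa [Constraint.subst] using hd
      refine ⟨_, fun v => (σ v).subst (ofList (e'.subst σ).mgu), .solve e' G' S B n, ?_⟩
      convert h.solve hw using 1
      rw [← hF]
      rfl
  · obtain ⟨mem, hguard⟩ := hw
    have hr := hP r mem
    -- the heads of the rule are images of constraints in the store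
    obtain ⟨H₁, H₂, S', rfl, hk, hrm, hF⟩ : ∃ H₁ H₂ S', S = H₁ + H₂ + S' ∧
        H₁.map (fun p => storeItem σ p.1) = ↑(r.kept.map (storeItem (ofList l))) ∧
        H₂.map (fun p => storeItem σ p.1) = ↑(r.removed.map (storeItem (ofList l))) ∧
        (F : Multiset (Item K)) = items σ G S' := by
      have e : (((r.kept ++ r.removed).map (storeItem (ofList l)) : List (Item K)) :
          Multiset (Item K)) + (F : Multiset (Item K)) = items σ G S := h.2
      have hG : (G.map (goalItem σ)).filter (fun x : Item K => x.1 = true) = 0 :=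
        Multiset.filter_eq_nil.2 (by simp [goalItem])
      have hS : (S.map fun p => storeItem σ p.1).filter (fun x : Item K => x.1 = true) =
          S.map fun p => storeItem σ p.1 :=
        Multiset.filter_eq_self.2 (by simp [storeItem])
      have e1 := congrArg (Multiset.filter fun x : Item K => x.1 = true) e
      rw [Multiset.filter_add, items, Multiset.filter_add,
        Multiset.filter_eq_self.2 (by simp [storeItem]),
        hG, zero_add, hS] at e1
      obtain ⟨H, S', rfl, hH, -⟩ := exists_add_of_map_eq_add e1.symm
      rw [List.map_append, ← Multiset.coe_add] at hH
      obtain ⟨H₁, H₂, rfl, h1, h2⟩ := exists_add_of_map_eq_add hH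
      refine ⟨H₁, H₂, S', rfl, h1, h2, ?_⟩
      rw [items, Multiset.map_add, Multiset.map_add, h1, h2, List.map_append,
        ← Multiset.coe_add] at e
      refine add_left_cancel (e.trans ?_)
      rw [items]
      abel
    set s : Config K := ⟨G, H₁ + H₂ + S', B, n⟩ with hs
    obtain ⟨N, hN⟩ := s.exists_vars_lt
    have hterm : ∀ v, ∃ t : Term K, v ∈ r.headVars →
        t.subst σ = ofList l v ∧ ∀ x ∈ t.vars, x ∈ s.vars := by
      intro v
      by_cases hv : v ∈ r.headVars
      · have : (H₁ + H₂).map (fun p => p.1.subst σ) =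
            ↑((r.kept ++ r.removed).map (Atom.subst (ofList l))) := by
          rw [Multiset.map_add, map_storeItem_eq_iff.1 hk, map_storeItem_eq_iff.1 hrm,
            List.map_append, Multiset.coe_add]
        obtain ⟨p, hp, t, ht, e⟩ := exists_arg_of_matching this hv
        exact ⟨t, fun _ => ⟨e, fun x hx => .inr (.inl
          ⟨p, Multiset.mem_add.2 (.inl hp), List.mem_flatMap.2 ⟨t, ht, hx⟩⟩)⟩⟩
      · exact ⟨.var 0, fun h => absurd h hv⟩
    choose g hg using hterm
    -- rename apart by a shift, and match each variable with the term chosen for its instance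
    let ρ : ℕ → ℕ := fun v => v + N
    let θ : ℕ → Term K := fun v => g (v - N)
    have hθρ : ∀ v, θ (ρ v) = g v := fun v => by simp [θ, ρ]
    have hge : ∀ v ∈ (r.rename ρ).vars, N ≤ v := by
      intro v hv
      have hat : ∀ A : List (Atom K), ∀ a ∈ A.map (Atom.subst fun v => .var (ρ v)),
          ∀ v ∈ a.vars, N ≤ v := by
        intro A a ha v hv
        obtain ⟨a, -, rfl⟩ := List.mem_map.1 ha
        rw [Atom.vars_rename] at hv
        obtain ⟨x, -, rfl⟩ := List.mem_map.1 hv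
        exact Nat.le_add_left N x
      have heq : ∀ e : Eqn K, ∀ v ∈ (e.subst fun v => .var (ρ v)).vars, N ≤ v := by
        intro e v hv
        simp only [Eqn.vars, Eqn.subst, Term.vars_rename, ← List.map_append] at hv
        obtain ⟨x, -, rfl⟩ := List.mem_map.1 hv
        exact Nat.le_add_left N x
      rcases List.mem_append.1 hv with hv | hv
      · rcases List.mem_append.1 hv with hv | hv
        · rw [Rule.headVars_rename] at hv
          obtain ⟨x, -, rfl⟩ := List.mem_map.1 hv
          exact Nat.le_add_left N x
        · obtain ⟨e, he, hv⟩ := List.mem_flatMap.1 hv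
          obtain ⟨e, -, rfl⟩ := List.mem_map.1 he
          exact heq e v hv
      · obtain ⟨c, hc, hv⟩ := List.mem_flatMap.1 hv
        obtain ⟨c, -, rfl⟩ := List.mem_map.1 hc
        cases c with
        | user a => exact hat [a] _ (by simp) v hv
        | builtin e => exact heq e v hv
    have hfresh : ∀ v ∈ (r.rename ρ).vars, v ∉ s.vars := fun v hv hv' =>
      absurd (hN v hv') (hge v hv).not_gt
    have hl : ∀ v ∈ r.headVars, ofList l v = (θ (ρ v)).subst σ := fun v hv => by
      rw [hθρ, (hg v hv).1]
    have hmatch : ∀ (H : Multiset (Atom K × ℕ)) (A : List (Atom K)),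
        (∀ a ∈ A, ∀ v ∈ a.vars, v ∈ r.headVars) →
        H.map (fun p => storeItem σ p.1) = ↑(A.map (storeItem (ofList l))) →
        Multiset.Rel (EntailsAtomEq B) (H.map Prod.fst)
          ↑((A.map (Atom.subst fun v => .var (ρ v))).map (Atom.subst θ)) := by
      intro H A hA e
      refine h.1.rel_entailsAtomEq_iff.2 ?_
      rw [Multiset.map_map]
      refine (map_storeItem_eq_iff.1 e).trans ?_
      rw [Multiset.map_coe, List.map_map, List.map_map]
      refine congrArg _ (List.map_congr_left fun a ha => ?_)
      simp only [Function.comp, Atom.subst_subst]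
      exact Atom.subst_congr fun v hv => hl v (hA a ha v hv)
    refine ⟨_, _, .apply G H₁ H₂ S' B n r _ ρ θ mem (add_left_injective N) rfl hfresh
      (hmatch H₁ r.kept (fun a ha v hv => List.mem_flatMap.2
        ⟨a, List.mem_append_left _ ha, hv⟩) hk)
      (hmatch H₂ r.removed (fun a ha v hv => List.mem_flatMap.2
        ⟨a, List.mem_append_right _ ha, hv⟩) hrm) ?_,
      Eq.mp (congrArg (Represents _ _) ?_)
        (h.apply hr hfresh (fun v hv => ⟨θ (ρ v), rfl, by rw [hθρ]; exact (hg v hv).2⟩)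
          hl hk)⟩
    · intro ν hν
      obtain ⟨μ, hμ⟩ := (h.1.1 ν).1 hν
      -- the guard is witnessed by evaluating the head variables through `θ`
      let ν' : ℕ → K := fun v => if v ∈ (r.rename ρ).headVars then (θ v).val ν else ν v
      have hV : ∀ v ∈ s.vars, ν' v = ν v := fun v hv =>
        if_neg fun hv' => hfresh v (by simp [Rule.vars, hv']) hv
      refine ⟨ν', hV, holds_add.2 ⟨holds_substEqns.2 fun v hv => ?_, ?_⟩⟩
      · refine (if_pos hv).trans ?_
        rw [Rule.headVars_rename] at hv
        obtain ⟨x, hx, rfl⟩ := List.mem_map.1 hv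
        rw [hθρ]
        exact Term.val_congr fun y hy => (hV y ((hg x hx).2 y hy)).symm
      · intro e he
        obtain ⟨e, he', rfl⟩ := List.mem_map.1 (Multiset.mem_coe.1 he)
        have hval : ∀ t : Term K, (∀ v ∈ t.vars, v ∈ e.vars) →
            (t.subst fun v => .var (ρ v)).val ν' = (t.subst (ofList l)).val μ := by
          intro t ht
          rw [Term.val_subst, Term.val_subst]
          refine Term.val_congr fun v hv => ?_
          have hv' : v ∈ r.headVars := hr v (.inr (List.mem_flatMap.2 ⟨e, he', ht v hv⟩))
          have hmem : ρ v ∈ (r.rename ρ).headVars := by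
            rw [Rule.headVars_rename]
            exact List.mem_map_of_mem hv'
          refine (if_pos hmem).trans ?_
          rw [hl v hv', Term.val_subst]
          exact Term.val_congr fun w _ => hμ w
        change (e.lhs.subst _).val ν' = (e.rhs.subst _).val ν'
        rw [hval _ fun v hv => List.mem_append_left _ hv,
          hval _ fun v hv => List.mem_append_right _ hv, hguard e he']
    · simp [Transition.post, ← Multiset.coe_add, hF]

end Simulation

section Certificates

variable {K : Type*}

/-! ### From certificates to infinite computations -/

theorem exists_sequence {α : Type*} {p : α → Prop} {R : α → α → Prop} {a : α} (ha : p a)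
    (h : ∀ x, p x → ∃ y, p y ∧ R x y) :
    ∃ u : ℕ → α, u 0 = a ∧ ∀ n, p (u n) ∧ R (u n) (u (n + 1)) := by
  choose f hp hR using h
  let F : {x // p x} → {x // p x} := fun x => ⟨f x.1 x.2, hp x.1 x.2⟩
  refine ⟨fun n => (F^[n] ⟨a, ha⟩).1, rfl, fun n => ⟨(F^[n] ⟨a, ha⟩).2, ?_⟩⟩
  beta_reduce
  rw [Function.iterate_succ_apply']
  exact hR _ _

/-- Transitions are monotone: the additional items of a larger state join the context. -/
theorem Transition.exists_extend {P : Program K} {w : Transition K} (hw : w.Valid P)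
    {M : Multiset (Item K)} (h : ↑w.pre ≤ M) :
    ∃ w' : Transition K, w'.Valid P ∧ M = ↑w'.pre ∧
      (w.post : Multiset (Item K)) ≤ ↑w'.post := by
  obtain ⟨R, rfl⟩ := Multiset.le_iff_exists_add.1 h
  obtain ⟨F, (a | e) | ⟨r, l⟩⟩ := w
  · refine ⟨(F ++ R.toList, .inl (.user a)), hw, ?_, ?_⟩
    · simp [Transition.pre, ← Multiset.coe_add, ← Multiset.cons_coe]
    · simp [Transition.post, ← Multiset.coe_add, ← Multiset.cons_coe]
  · refine ⟨(F ++ R.toList, .inl (.builtin e)), hw, ?_, ?_⟩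
    · simp [Transition.pre, ← Multiset.coe_add, ← Multiset.cons_coe]
    · simp only [Transition.post, List.map_append, ← Multiset.coe_add]
      exact Multiset.le_add_right _ _
  · refine ⟨(F ++ R.toList, .inr (r, l)), hw, ?_, ?_⟩
    · simp [Transition.pre, ← Multiset.coe_add, add_assoc]
    · simp only [Transition.post, ← Multiset.coe_add, ← add_assoc]
      exact Multiset.le_add_right _ _

/-- The invariant of the computation constructed from a certificate: its configurations are
represented by states that include the premise of some transition in the certificate. -/
theorem exists_infiniteComputation_of_certificate [Nonempty K] {σ : ℕ → Term K}
    (hσ : SolvedForm 0 σ) {P : Program K} (hP : P.RangeRestricted) {G : Goal K}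
    {T : List (Transition K)} (hT : Certificate σ P G T) :
    ∃ s, InfiniteComputation P G s := by
  obtain ⟨u, h0, hu⟩ := exists_sequence
    (p := fun s : Config K => ∃ M τ, Represents τ s M ∧
      ∃ w ∈ T, (w.pre : Multiset (Item K)) ≤ M)
    (R := fun s s' => Step P s s') (a := Config.initial G)
    (by
      obtain ⟨w, hw, hle⟩ := hT.1
      exact ⟨_, σ, ⟨hσ, rfl⟩, w, hw, by simpa [items, Config.initial] using hle⟩)
    (by
      rintro s ⟨M, τ, hM, w, hw, hle⟩
      obtain ⟨hv, w₁, hw₁, hle₁⟩ := hT.2 w hw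
      obtain ⟨w', hv', rfl, hle'⟩ := Transition.exists_extend hv hle
      obtain ⟨s', τ', hs, hM'⟩ := hM.exists_step hP hv'
      exact ⟨s', ⟨_, τ', hM', w₁, hw₁, (Multiset.coe_le.2 hle₁).trans hle'⟩, hs⟩)
  refine ⟨u, h0, fun i => ⟨?_, (hu i).2⟩⟩
  obtain ⟨⟨M, τ, hM, -⟩, hs⟩ := hu i
  rintro (hf | ⟨-, hn⟩)
  exacts [hM.not_failed hf, hn ⟨_, hs⟩]

/-! ### Finiteness of the set of items that can occur -/

/-- The arguments of an atom, or the two sides of an equation. -/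
def Constraint.terms : Constraint K → List (Term K)
  | .user a => a.args
  | .builtin e => [e.lhs, e.rhs]

/-- The terms of `c` belong to `T`, and if `c` is user-defined then its predicate symbol, both name
and arity, is bounded by `N`. -/
def Constraint.Bounded (T : Set (Term K)) (N : ℕ) (c : Constraint K) : Prop :=
  (∀ t ∈ c.terms, t ∈ T) ∧ ∀ a, c = .user a → a.pred ≤ N ∧ a.args.length ≤ N

theorem Constraint.mem_vars_iff {c : Constraint K} {v : ℕ} :
    v ∈ c.vars ↔ .var v ∈ c.terms := by
  have h : ∀ t : Term K, v ∈ t.vars ↔ .var v = t := by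
    rintro (w | k) <;> simp [Term.vars]
  cases c <;> simp [Constraint.vars, Constraint.terms, Atom.vars, Eqn.vars, h]

theorem Constraint.terms_subst (θ : ℕ → Term K) (c : Constraint K) :
    (c.subst θ).terms = c.terms.map (Term.subst θ) := by
  cases c <;> rfl

theorem Constraint.Bounded.subst {T : Set (Term K)} {N : ℕ} {c : Constraint K}
    (h : c.Bounded T N) {θ : ℕ → Term K} (hθ : ∀ v ∈ c.vars, θ v ∈ T) :
    (c.subst θ).Bounded T N := by
  constructor
  · intro t ht
    rw [Constraint.terms_subst] at ht
    obtain ⟨t, ht', rfl⟩ := List.mem_map.1 ht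
    cases t with
    | var v => exact hθ v (Constraint.mem_vars_iff.2 ht')
    | const k => exact h.1 _ ht'
  · intro a ha
    cases c with
    | user b =>
      obtain rfl : b.subst θ = a := by simpa [Constraint.subst] using ha
      simpa [Atom.subst] using h.2 b rfl
    | builtin e => simp [Constraint.subst] at ha

theorem finite_bounded {T : Set (Term K)} (hT : T.Finite) (N : ℕ) :
    {c : Constraint K | c.Bounded T N}.Finite := by
  have : Finite T := hT
  have hl : {l : List (Term K) | l.length ≤ N ∧ ∀ t ∈ l, t ∈ T}.Finite := by
    refine ((List.finite_length_le T N).image (List.map Subtype.val)).subset ?_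
    rintro l ⟨hN, hl⟩
    lift l to List T using hl
    exact ⟨l, by simpa using hN, rfl⟩
  refine (((Set.finite_Iic N).image2 (fun p l => Constraint.user ⟨p, l⟩) hl).union
    (hT.image2 (fun l r => Constraint.builtin ⟨l, r⟩) hT)).subset ?_
  rintro (⟨p, l⟩ | ⟨l, r⟩) hc
  · exact .inl ⟨p, (hc.2 _ rfl).1, l, ⟨(hc.2 _ rfl).2, hc.1⟩, rfl⟩
  · exact .inr ⟨l, hc.1 _ (by simp [Constraint.terms]), r,
      hc.1 _ (by simp [Constraint.terms]), rfl⟩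

theorem exists_bounded (L : List (Constraint K)) :
    ∃ (T : Set (Term K)) (N : ℕ), T.Finite ∧ ∀ c ∈ L, c.Bounded T N := by
  refine ⟨{t | t ∈ L.flatMap Constraint.terms},
    (L.map fun c => match c with
      | .user a => a.pred + a.args.length
      | .builtin _ => 0).sum, List.finite_toSet _, fun c hc => ⟨fun t ht =>
        List.mem_flatMap.2 ⟨c, hc, ht⟩, ?_⟩⟩
  rintro a rfl
  have := List.le_sum_of_mem (List.mem_map_of_mem (f := fun c : Constraint K => match c with
      | .user a => a.pred + a.args.length
      | .builtin _ => 0) hc)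
  dsimp only at this
  omega

theorem Eqn.ofList_mgu_mem (e : Eqn K) (v : ℕ) :
    ofList e.mgu v = .var v ∨ ofList e.mgu v = e.lhs ∨ ofList e.mgu v = e.rhs := by
  obtain ⟨l, r⟩ := e
  cases l with
  | var x => simp only [Eqn.mgu, ofList_single]; split_ifs <;> simp
  | const a =>
    cases r with
    | var x => simp only [Eqn.mgu, ofList_single]; split_ifs <;> simp
    | const b => exact .inl rfl

/-- This is where range restriction is needed: transitions create no new terms. -/
theorem Transition.bounded_post {P : Program K} (hP : P.RangeRestricted) {T : Set (Term K)}
    {N : ℕ} (hb : ∀ r ∈ P, ∀ c ∈ r.body, c.Bounded T N) {w : Transition K} (hw : w.Valid P)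
    (h : ∀ x ∈ w.pre, x.2.Bounded T N) : ∀ x ∈ w.post, x.2.Bounded T N := by
  obtain ⟨F, (a | e) | ⟨r, l⟩⟩ := w
  · intro x hx
    rcases List.mem_cons.1 hx with rfl | hx
    · exact h (false, .user a) (by simp [Transition.pre])
    · exact h x (List.mem_cons_of_mem _ hx)
  · intro x hx
    obtain ⟨y, hy, rfl⟩ := List.mem_map.1 hx
    have he := h (false, .builtin e) (by simp [Transition.pre])
    have hyb := h y (List.mem_cons_of_mem _ hy)
    refine hyb.subst fun v hv => ?_
    rcases e.ofList_mgu_mem v with hm | hm | hm <;> rw [hm]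
    · exact hyb.1 _ (Constraint.mem_vars_iff.1 hv)
    · exact he.1 _ (by simp [Constraint.terms])
    · exact he.1 _ (by simp [Constraint.terms])
  · intro x hx
    rcases List.mem_append.1 hx with hx | hx
    · obtain ⟨c, hc, rfl⟩ := List.mem_map.1 hx
      refine (hb r hw.1 c hc).subst fun v hv => ?_
      obtain ⟨a, ha, hva⟩ := List.mem_flatMap.1
        (hP r hw.1 v (.inl (List.mem_flatMap.2 ⟨c, hc, hv⟩)))
      exact (h (storeItem (ofList l) a)
        (List.mem_append_left _ (List.mem_map_of_mem ha))).1 _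
        (Atom.mem_args_subst_of_mem_vars hva)
    · refine h x ?_
      simp only [Transition.pre, List.map_append, List.mem_append] at hx ⊢
      tauto

/-! ### From infinite computations to certificates -/

theorem exists_certificate_of_infiniteComputation {σ : ℕ → Term K}
    (hσ : SolvedForm 0 σ) {P : Program K} (hP : P.RangeRestricted) {G : Goal K}
    {s : ℕ → Config K} (hs : InfiniteComputation P G s) : ∃ T, Certificate σ P G T := by
  obtain ⟨h0, hstep⟩ := hs
  -- an infinite run `w` of the abstract system
  obtain ⟨w, hval, hw0, hpost⟩ : ∃ w : ℕ → Transition K, (∀ i, (w i).Valid P) ∧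
      (w 0).pre.Perm (G.map (goalItem σ)) ∧ ∀ i, (w (i + 1)).pre.Perm (w i).post := by
    obtain ⟨u, hu0, hu⟩ := exists_sequence (α := ℕ × Multiset (Item K) × (ℕ → Term K))
      (p := fun q => Represents q.2.2 (s q.1) q.2.1)
      (R := fun q q' => ∃ w : Transition K, w.Valid P ∧ q.2.1 = ↑w.pre ∧ q'.2.1 = ↑w.post)
      (a := (0, ↑(G.map (goalItem σ)), σ))
      (by
        dsimp only
        rw [h0]
        exact ⟨hσ, by simp [items, Config.initial]⟩)
      (by
        rintro ⟨i, M, τ⟩ hM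
        obtain ⟨w, hw, hpre, τ', hM'⟩ := hM.exists_transition hP (hstep i).2
          fun hf => (hstep (i + 1)).1 (.inl hf)
        exact ⟨(i + 1, _, τ'), hM', w, hw, hpre, rfl⟩)
    choose w hw hpre hpost using fun n => (hu n).2
    refine ⟨w, hw, ?_, fun i => ?_⟩
    · rw [← Multiset.coe_eq_coe, ← hpre 0, hu0]
    · rw [← Multiset.coe_eq_coe, ← hpre (i + 1), hpost i]
  obtain ⟨T, N, hT, hb⟩ := exists_bounded (G.map (Constraint.subst σ) ++ P.flatMap Rule.body)
  have hbody : ∀ r ∈ P, ∀ c ∈ r.body, c.Bounded T N := fun r hr c hc =>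
    hb c (List.mem_append_right _ (List.mem_flatMap.2 ⟨r, hr, hc⟩))
  have hbound : ∀ i, ∀ x ∈ (w i).pre, x.2.Bounded T N := by
    intro i
    induction i with
    | zero =>
      intro x hx
      obtain ⟨c, hc, rfl⟩ := List.mem_map.1 (hw0.mem_iff.1 hx)
      exact hb _ (List.mem_append_left _ (List.mem_map_of_mem hc))
    | succ i ih =>
      intro x hx
      exact Transition.bounded_post hP hbody (hval i) ih x ((hpost i).mem_iff.1 hx)
  have hfin : {x : Item K | x.2.Bounded T N}.Finite :=
    (Set.finite_univ.prod (finite_bounded hT N)).subset fun x hx => ⟨trivial, hx⟩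
  obtain ⟨i, j, hij, hle⟩ := Set.PartiallyWellOrderedOn.partiallyWellOrderedOn_sublistForall₂
    (r := Eq) hfin.partiallyWellOrderedOn fun n => ⟨(w n).pre, hbound n⟩
  have hsub : (w i).pre.Subperm (w j).pre := by
    obtain ⟨l, hl, hlj⟩ := List.sublistForall₂_iff.1 hle
    rw [List.forall₂_eq_eq_eq] at hl
    subst hl
    exact hlj.subperm
  -- the last transition is followed by the one at `i`, as its result includes `(w i).pre`
  refine ⟨(List.range j).map w, ⟨w 0, List.mem_map_of_mem (by simp; omega), hw0.subperm⟩, ?_⟩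
  intro v hv
  obtain ⟨k, hk, rfl⟩ := List.mem_map.1 hv
  rw [List.mem_range] at hk
  refine ⟨hval k, ?_⟩
  rcases Nat.lt_or_ge (k + 1) j with hk' | hk'
  · exact ⟨w (k + 1), List.mem_map_of_mem (List.mem_range.2 hk'), (hpost k).subperm⟩
  · obtain rfl : j = k + 1 := by omega
    exact ⟨w i, List.mem_map_of_mem (List.mem_range.2 hij),
      hsub.trans (hpost k).subperm⟩

end Certificates

end CHR

theorem mainTheorem2 (K : Type*) [Primcodable K] [Nonempty K] :
    ¬ ∃ f : CHR.TuringMachine × List ℕ → CHR.Program K × CHR.Goal K,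
      Computable f ∧ CHR.IntoRangeRestricted f ∧ CHR.TerminationPreserving f := by
  rintro ⟨f, hf, hrr, htp⟩
  have hre : REPred fun n : ℕ =>
      ((Denumerable.ofNat Nat.Partrec.Code n).eval 0).Dom :=
    Partrec.comp (ComputablePred.halting_problem_re 0) (Computable.ofNat _)
  -- `Z` halts on the input encoding the number of a code if and only if this code halts at `0`
  obtain ⟨Z, D, hD, hZ⟩ := CHR.exists_turingMachine_halts_iff hre
  obtain ⟨σ, hσ, hsolved⟩ := CHR.exists_solvedForm_zero (K := K)
  refine ComputablePred.halting_problem_not_re 0 ?_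
  have hg : Computable fun c : Nat.Partrec.Code => f (Z, D (Encodable.encode c)) :=
    hf.comp ((Computable.const Z).pair (hD.to_comp.comp Computable.encode))
  have hcert : REPred fun c : Nat.Partrec.Code => ∃ T, CHR.Certificate σ
      (f (Z, D (Encodable.encode c))).1 (f (Z, D (Encodable.encode c))).2 T :=
    Partrec.comp (CHR.rePred_exists_certificate hσ) hg
  refine hcert.of_eq fun c => ?_
  have h1 := (hZ (Encodable.encode c)).symm.trans (htp Z (D (Encodable.encode c)))
  rw [Denumerable.ofNat_encode] at h1
  rw [h1, CHR.OnlyTerminatingComputations, not_not]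
  have hP := (hrr Z (D (Encodable.encode c))).2
  exact ⟨fun ⟨T, hT⟩ => CHR.exists_infiniteComputation_of_certificate hsolved hP hT,
    fun ⟨s, hs⟩ => CHR.exists_certificate_of_infiniteComputation hsolved hP hs⟩
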